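/- Let $\mathbb F_q$ be a finite field of odd order $q$ and characteristic $p$, let $d$ be odd, and for $r\in\mathbb F_q$ let $S_r=\{x\in\mathbb F_q^d:\sum_j x_j^2=r\}$. Radii are assumed to satisfy $S_r\neq\emptyset$ (this is automatic for $d\ge 3$). *Oracle.* Let $A,B$ be finite abelian groups whose nonzero elements serve as labels and whose element $0$ is the blank symbol. A hidden radius oracle for $r$ is given by an injective encryption $\sigma:S_r\to A\setminus\{0\}$ of the offsets and an injective encryption $\tau:\mathbb F_q^d\to B\setminus\{0\}$ of the centers. It computes two functions: $f_1(x,\sigma(s))=\tau(x-s)$ for $x\in\mathbb F_q^d$ and $s\in S_r$, and $f_{-1}(x,\tau(t))=\sigma(x-t)$ whenever $x-t\in S_r$; both return $0$ on every other input. A quantum query is one application of $|x,a,b\rangle\mapsto|x,a,b+f_1(x,a)\rangle$ or of $|x,a,b\rangle\mapsto|x,a+f_{-1}(x,b),b\rangle$. A quantum query algorithm starts from a fixed basis state, alternates queries with oracle-independent unitaries (on these registers and a finite work space), measures in the computational basis, and outputs a function of the outcome. *Fourier sampling.* With $\omega_p=e^{2\pi i/p}$, let $|S_r+t\rangle$ be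 the normalized uniform superposition over $S_r+t$, let $\rho_r=q^{-d}\sum_{t\in\mathbb F_q^d}|S_r+t\rangle\langle S_r+t|$, let $U=q^{-d/2}\sum_{k,x\in\mathbb F_q^d}\omega_p^{\operatorname{Tr}(k\cdot x)}|k\rangle\langle x|$ with $\operatorname{Tr}$ the trace from $\mathbb F_q$ to $\mathbb F_p$, and let $\Pr(k|r)=\langle k|U\rho_rU^\dagger|k\rangle$ be the resulting distribution of $k$. **Theorem.** 1. For every $K\in\mathbb N$ and $\varepsilon>0$ there are constants $C,c$ such that for all odd $q$, all odd $d$ and all label groups $A,B$ with $|A|\le Kq^{d-1}$ there is a quantum query algorithm, depending only on $(\mathbb F_q,d,A,B,K,\varepsilon)$, that makes at most $C(\log q)^c$ queries and that, for every radius $r$ with $S_r\ne\emptyset$ and every hidden radius oracle for $r$ with labels in $A$ and $B$, outputs $r$ with probability at least $1-\varepsilon$. 2. There is an absolute constant $\delta>0$ such that for all odd $q$, all odd $d$ and all $r\neq r'$ with $S_r,S_{r'}\neq\emptyset$, the distributions $\Pr(\cdot|r)$ and $\Pr(\cdot|r')$ have total variation distance $\frac12\sum_k|\Pr(k|r)-\Pr(k|r')|\ge\delta$.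 3. If moreover $r$ and $r'$ have the same quadratic character, this total variation distance is at least $\frac14$. -/

import Mathlib

open scoped Classical in
/-- The sphere of radius `r` centred at the origin of `F^d`, i.e. the points `x` with
`x_1 ^ 2 + ... + x_d ^ 2 = r`. -/
noncomputable def radiusSphere {F : Type} [Field F] [Fintype F] (d : ℕ) (r : F) :
    Finset (Fin d → F) :=
  Finset.univ.filter fun x => ∑ j, x j ^ 2 = r

/-! ## The hidden radius oracle -/

/-- The data behind a black box hiding the radius `r`: an encryption of the points of the sphere
of radius `r` by elements of `A`, and an encryption of the possible centres by elements of `B`.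
Labels are nonzero elements of the finite abelian groups `A` and `B`; the element `0` is kept as
the blank symbol, which is also the answer to an invalid query. -/
structure HiddenRadiusOracle (F : Type) [Field F] [Fintype F] (d : ℕ)
    (A B : Type) [AddCommGroup A] [AddCommGroup B] (r : F) where
  /-- encryption of the offsets `s` with `s` on the sphere -/
  encOffset : {s : Fin d → F // s ∈ radiusSphere d r} ↪ {a : A // a ≠ 0}
  /-- encryption of the centres `t` -/
  encCenter : (Fin d → F) ↪ {b : B // b ≠ 0}

namespace HiddenRadiusOracle

variable {F : Type} [Field F] [Fintype F] {d : ℕ}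
  {A B : Type} [AddCommGroup A] [AddCommGroup B] {r : F}

open scoped Classical in
/-- The black box `f₁`: on a point `x` and the encryption `a` of an offset `s`, it returns the
encryption of the centre `x - s`; it returns `0` if `a` encrypts no point of the sphere. -/
noncomputable def fwd (O : HiddenRadiusOracle F d A B r) (x : Fin d → F) (a : A) : B :=
  if h : ∃ s, (O.encOffset s : A) = a then (O.encCenter (x - h.choose.1) : B) else 0

open scoped Classical in
/-- The black box `f₋₁`: on a point `x` and the encryption `b` of a centre `t`, it returns the
encryption of the offset `x - t`; it returns `0` if there are no `t` and no offset `s = x - t` on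
the sphere such that `b` is the encryption of `t`. -/
noncomputable def bwd (O : HiddenRadiusOracle F d A B r) (x : Fin d → F) (b : B) : A :=
  if h : ∃ s : {s : Fin d → F // s ∈ radiusSphere d r}, (O.encCenter (x - s.1) : B) = b then
    (O.encOffset h.choose : A) else 0

theorem fwd_encOffset (O : HiddenRadiusOracle F d A B r) (x : Fin d → F)
    (s : {s : Fin d → F // s ∈ radiusSphere d r}) :
    O.fwd x (O.encOffset s) = O.encCenter (x - s.1) := by
  have h : ∃ s', (O.encOffset s' : A) = O.encOffset s := ⟨s, rfl⟩
  have h' : h.choose = s := O.encOffset.injective (Subtype.ext h.choose_spec)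
  rw [fwd, dif_pos h, h']

theorem bwd_encCenter (O : HiddenRadiusOracle F d A B r) (x : Fin d → F)
    (s : {s : Fin d → F // s ∈ radiusSphere d r}) :
    O.bwd x (O.encCenter (x - s.1)) = O.encOffset s := by
  have h : ∃ s' : {s : Fin d → F // s ∈ radiusSphere d r},
      (O.encCenter (x - s'.1) : B) = O.encCenter (x - s.1) := ⟨s, rfl⟩
  have h' : h.choose = s := Subtype.ext
    (sub_right_injective (O.encCenter.injective (Subtype.ext h.choose_spec)))
  rw [bwd, dif_pos h, h']

end HiddenRadiusOracle

/-! ## Quantum query algorithms -/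

/-- The computational basis: a point register, an offset-label register, a centre-label register,
and a work space `W`. -/
abbrev QReg (F : Type) (d : ℕ) (A B W : Type) : Type := (Fin d → F) × A × B × W

/-- Which of the two black boxes is queried. -/
inductive QueryKind
  | fwd
  | bwd

/-- The quantum oracle. A query to `f₁` is the unitary
`|x, a, b, w⟩ ↦ |x, a, b + f₁(x, a), w⟩`, and a query to `f₋₁` is the unitary
`|x, a, b, w⟩ ↦ |x, a + f₋₁(x, b), b, w⟩`; here they act on vectors of amplitudes. -/
noncomputable def HiddenRadiusOracle.query {F : Type} [Field F] [Fintype F] {d : ℕ}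
    {A B : Type} [AddCommGroup A] [AddCommGroup B] {r : F}
    (O : HiddenRadiusOracle F d A B r) {W : Type} (κ : QueryKind)
    (ψ : QReg F d A B W → ℂ) : QReg F d A B W → ℂ :=
  match κ with
  | .fwd => fun (x, a, b, w) => ψ (x, a, b - O.fwd x a, w)
  | .bwd => fun (x, a, b, w) => ψ (x, a - O.bwd x b, b, w)

/-- A quantum query algorithm that returns an element of `F`: starting from a computational basis
state it applies a unitary, then alternates queries with further unitaries, and finally measures
all registers in the computational basis and applies a function to the outcome. Nothing here
depends on the hidden oracle. -/
structure QueryAlgorithm (F : Type) [Field F] [Fintype F] [DecidableEq F] (d : ℕ)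
    (A B : Type) [AddCommGroup A] [Fintype A] [DecidableEq A]
    [AddCommGroup B] [Fintype B] [DecidableEq B] where
  W : Type
  [fintypeW : Fintype W]
  [decidableEqW : DecidableEq W]
  w₀ : W
  first : Matrix.unitaryGroup (QReg F d A B W) ℂ
  /-- each entry is a query followed by a unitary -/
  steps : List (QueryKind × Matrix.unitaryGroup (QReg F d A B W) ℂ)
  output : QReg F d A B W → F

namespace QueryAlgorithm

attribute [instance] QueryAlgorithm.fintypeW QueryAlgorithm.decidableEqW

variable {F : Type} [Field F] [Fintype F] [DecidableEq F] {d : ℕ}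
  {A B : Type} [AddCommGroup A] [Fintype A] [DecidableEq A]
  [AddCommGroup B] [Fintype B] [DecidableEq B]

/-- The number of queries made. -/
def numQueries (alg : QueryAlgorithm F d A B) : ℕ := alg.steps.length

/-- The state before the final measurement, for a given oracle. -/
noncomputable def finalState (alg : QueryAlgorithm F d A B) {r : F}
    (O : HiddenRadiusOracle F d A B r) : QReg F d A B alg.W → ℂ :=
  alg.steps.foldl (fun ψ st => Matrix.mulVec st.2.1 (O.query st.1 ψ))
    (Matrix.mulVec alg.first.1 (Pi.single ((0, 0, 0, alg.w₀) : QReg F d A B alg.W) (1 : ℂ)))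

/-- The probability that the algorithm returns `v`. -/
noncomputable def prob (alg : QueryAlgorithm F d A B) {r : F}
    (O : HiddenRadiusOracle F d A B r) (v : F) : ℝ :=
  ∑ z : QReg F d A B alg.W, if alg.output z = v then ‖alg.finalState O z‖ ^ 2 else 0

end QueryAlgorithm

/-! ## Fourier sampling of the hidden radius state -/

section FourierSampling

variable {F : Type} [Field F] [Fintype F] {d : ℕ}

/-- `exp (2 π i Tr(a) / p)`, with `p` the characteristic of `F` and `Tr` the absolute trace. -/
noncomputable def traceChar (a : F) : ℂ :=
  letI : Algebra (ZMod (ringChar F)) F := ZMod.algebra F (ringChar F)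
  Complex.exp (2 * Real.pi * Complex.I *
    ((Algebra.trace (ZMod (ringChar F)) F a).val : ℂ) / (ringChar F : ℂ))

open scoped Classical in
/-- The normalized uniform superposition over the sphere of radius `r` centred at `t`. -/
noncomputable def sphereState (r : F) (t : Fin d → F) : (Fin d → F) → ℂ := fun x =>
  if x - t ∈ radiusSphere d r then ((1 / Real.sqrt (radiusSphere d r).card : ℝ) : ℂ) else 0

/-- The hidden radius state: the sphere state averaged over a uniformly random centre. -/
noncomputable def hiddenRadiusState (d : ℕ) (r : F) : Matrix (Fin d → F) (Fin d → F) ℂ :=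
  (1 / (Fintype.card F : ℂ) ^ d) •
    ∑ t : Fin d → F, Matrix.vecMulVec (sphereState r t) (star (sphereState r t))

/-- The Fourier transform over `F^d`. -/
noncomputable def fourierMatrix (F : Type) [Field F] [Fintype F] (d : ℕ) :
    Matrix (Fin d → F) (Fin d → F) ℂ :=
  Matrix.of fun k x =>
    ((1 / Real.sqrt ((Fintype.card F : ℝ) ^ d) : ℝ) : ℂ) * traceChar (k ⬝ᵥ x)

/-- The probability of the outcome `k` when the hidden radius state of radius `r` is Fourier
transformed and measured in the computational basis. -/
noncomputable def fourierProb (r : F) (k : Fin d → F) : ℝ :=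
  ((fourierMatrix F d * hiddenRadiusState d r * (fourierMatrix F d).conjTranspose) k k).re

/-- The total variation distance between the Fourier sampling distributions of two radii. -/
noncomputable def fourierTV (d : ℕ) (r r' : F) : ℝ :=
  (1 / 2) * ∑ k : Fin d → F, |fourierProb r k - fourierProb r' k|

end FourierSampling

/-!
Write `χ` for the quadratic character of `F`, `g` for its Gauss sum and `z = k ⬝ᵥ k`. Detecting
`∑ xⱼ² = r` by additive characters and completing squares turns the Fourier transform of the
sphere into products of Gauss sums. For odd `d` and `z ≠ 0` it equals `χ(z) g^(d-1)` times the same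
sum for `d = 1`, which is just `∑_{w² = z r} ψ(w)`. Hence `Pr(k|r)` vanishes when `z r` is not a
square and is proportional to `2 + 2 Re ψ(2v)` when `z r = v² ≠ 0`. Substituting `z = r u²`, which
meets each value at most twice, bounds the total variation distance from below by a sum over `u` of
differences of cosines. Two nonzero radii with the same character give orthogonal cosines, hence
`1/4`; two nonzero radii with different characters give disjoint supports on `z ≠ 0`; and the
radius `0` gives a constant function of `z ≠ 0`, which differs from that of another radius at the
nonsquares `z r` if `d ≥ 3` and by a cosine at the squares if `d = 1`.

On a uniform superposition of points and offset labels, a query to `f₁` followed by one to `f₋₁`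
produces a centre label while erasing the offset label. What remains is the sphere state, and this
succeeds with probability `|S_r| / |A| ≥ 2/(3K)`. The sample distributions of different radii thus
have total variation distance bounded away from `0`, and Bhattacharyya coefficient bounded away
from `1`. Exchanging registers with fresh copies in the work space gives `n` independent samples,
for which maximum likelihood confuses `r` with a given other radius with probability at most the
`n`-th power of the Bhattacharyya coefficient. A union bound over the `q` radii shows that
`n = O(log q)` suffices.
-/

/-! ## Quadratic Gauss sums -/

section CharacterSums

variable {F R : Type*} [Field F] [Fintype F] [CommRing R]

theorem addChar_map_sum {G ι : Type*} [AddCommMonoid G] (ψ : AddChar G R) (s : Finset ι)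
    (f : ι → G) : ψ (∑ i ∈ s, f i) = ∏ i ∈ s, ψ (f i) :=
  map_prod ψ.toMonoidHom (fun i => Multiplicative.ofAdd (f i)) s

theorem norm_gaussSum_sq {χ : MulChar F ℂ} (hχ : χ ≠ 1) {ψ : AddChar F ℂ} (hψ : ψ.IsPrimitive) :
    ‖gaussSum χ ψ‖ ^ 2 = Fintype.card F := by
  have hconj : gaussSum χ⁻¹ ψ⁻¹ = starRingEnd ℂ (gaussSum χ ψ) := by
    rw [gaussSum, gaussSum, map_sum]
    refine Finset.sum_congr rfl fun a _ => ?_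
    rw [map_mul, ← AddChar.map_neg_eq_conj, AddChar.inv_apply, starRingEnd_apply,
      MulChar.star_apply']
  have h := gaussSum_mul_gaussSum_eq_card hχ hψ
  rw [hconj, Complex.mul_conj'] at h
  exact_mod_cast h

variable [DecidableEq F]

variable (F R) in
/-- The quadratic character of `F` with values in the ring `R`. -/
def quadraticMulChar : MulChar F R :=
  (quadraticChar F).ringHomComp (Int.castRingHom R)

theorem quadraticMulChar_apply (a : F) : quadraticMulChar F R a = (quadraticChar F a : R) := rfl

theorem isQuadratic_quadraticMulChar : (quadraticMulChar F R).IsQuadratic :=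
  (quadraticChar_isQuadratic F).comp _

theorem quadraticMulChar_ne_one [CharZero R] (hF : ringChar F ≠ 2) : quadraticMulChar F R ≠ 1 :=
  (MulChar.ringHomComp_ne_one_iff (RingHom.injective_int _)).2 (quadraticChar_ne_one hF)

theorem norm_quadraticMulChar {a : F} (ha : a ≠ 0) : ‖quadraticMulChar F ℂ a‖ = 1 := by
  rcases quadraticChar_dichotomy ha with h | h <;> simp [quadraticMulChar_apply, h]

theorem sum_comp_sq (hF : ringChar F ≠ 2) (f : F → R) :
    ∑ x, f (x ^ 2) = ∑ y, (quadraticMulChar F R y + 1) * f y := by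
  rw [← Finset.sum_fiberwise' _ (fun x : F => x ^ 2)]
  refine Finset.sum_congr rfl fun y _ => ?_
  have hcard : ((Finset.univ.filter fun x : F => x ^ 2 = y).card : ℤ) = quadraticChar F y + 1 := by
    rw [← quadraticChar_card_sqrts hF y, Set.toFinset_ofPred]
  rw [Finset.sum_const, nsmul_eq_mul, quadraticMulChar_apply]
  congr 1
  exact_mod_cast congrArg (Int.cast : ℤ → R) hcard

theorem sum_quadraticMulChar_mul_addChar [IsDomain R] [CharZero R] (hF : ringChar F ≠ 2)
    (ψ : AddChar F R) (a : F) :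
    ∑ y, quadraticMulChar F R y * ψ (a * y) =
      quadraticMulChar F R a * gaussSum (quadraticMulChar F R) ψ := by
  rcases eq_or_ne a 0 with rfl | ha
  · simp [MulChar.sum_eq_zero_of_ne_one (quadraticMulChar_ne_one hF), MulChar.map_zero]
  · simpa [isQuadratic_quadraticMulChar.inv, gaussSum] using
      gaussSum_mulShift_eq (quadraticMulChar F R) ψ (Units.mk0 a ha)

variable [IsDomain R] [CharZero R] {ψ : AddChar F R}

theorem sum_addChar_quadratic (hF : ringChar F ≠ 2) (hψ : ψ.IsPrimitive) {a : F} (ha : a ≠ 0)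
    (b : F) :
    ∑ x, ψ (a * x ^ 2 + b * x) =
      quadraticMulChar F R a * gaussSum (quadraticMulChar F R) ψ * ψ (-(b ^ 2 / (4 * a))) := by
  have h2 : (2 : F) ≠ 0 := Ring.two_ne_zero hF
  have hsquare (x : F) : ψ (a * (x - b / (2 * a)) ^ 2 + b * (x - b / (2 * a))) =
      ψ (a * x ^ 2) * ψ (-(b ^ 2 / (4 * a))) := by
    rw [← AddChar.map_add_eq_mul, show (4 : F) = 2 ^ 2 by norm_num]
    congr 1
    field
  have hlinear : ∑ y, ψ (a * y) = 0 := by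
    simpa [mul_comm, ha] using AddChar.sum_mulShift a hψ
  rw [← (Equiv.subRight (b / (2 * a))).sum_comp]
  simp only [Equiv.subRight_apply, hsquare]
  rw [← Finset.sum_mul, sum_comp_sq hF fun y => ψ (a * y)]
  simp only [add_mul, one_mul]
  rw [Finset.sum_add_distrib, sum_quadraticMulChar_mul_addChar hF, hlinear, add_zero]

end CharacterSums

/-! ## The Fourier transform of a sphere -/

section SphereFourier

variable {F : Type} [Field F] [Fintype F] {R : Type*} [CommRing R] {d : ℕ}

/-- The Fourier transform, with respect to the additive character `ψ`, of the indicator function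
of the sphere of radius `r`. -/
noncomputable def sphereFourier (ψ : AddChar F R) (r : F) (k : Fin d → F) : R :=
  ∑ s ∈ radiusSphere d r, ψ (k ⬝ᵥ s)

theorem mem_radiusSphere {r : F} {x : Fin d → F} : x ∈ radiusSphere d r ↔ ∑ j, x j ^ 2 = r := by
  simp [radiusSphere]

theorem sphereFourier_zero (ψ : AddChar F R) (r : F) :
    sphereFourier ψ r (0 : Fin d → F) = (radiusSphere d r).card := by
  simp [sphereFourier]

theorem sum_addChar_dotProduct_eq_prod (ψ : AddChar F R) (k : Fin d → F) :
    ∑ x, ψ (k ⬝ᵥ x) = ∏ j, ∑ x, ψ (k j * x) := by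
  classical
  rw [Finset.prod_univ_sum, Fintype.piFinset_univ]
  simp only [dotProduct, addChar_map_sum]

theorem card_mul_sphereFourier_eq_sum_prod [IsDomain R] {ψ : AddChar F R} (hψ : ψ.IsPrimitive)
    (r : F) (k : Fin d → F) :
    (Fintype.card F : R) * sphereFourier ψ r k =
      ∑ a, ψ (-(a * r)) * ∏ j, ∑ x, ψ (a * x ^ 2 + k j * x) := by
  classical
  have hindicator : (Fintype.card F : R) * sphereFourier ψ r k =
      ∑ a, ∑ x : Fin d → F, ψ (a * (∑ j, x j ^ 2 - r)) * ψ (k ⬝ᵥ x) := by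
    rw [Finset.sum_comm, sphereFourier, radiusSphere, Finset.sum_filter, Finset.mul_sum]
    refine Finset.sum_congr rfl fun x _ => ?_
    rw [← Finset.sum_mul, AddChar.sum_mulShift _ hψ]
    simp [sub_eq_zero]
  rw [hindicator]
  refine Finset.sum_congr rfl fun a _ => ?_
  rw [Finset.prod_univ_sum, Fintype.piFinset_univ, Finset.mul_sum]
  refine Finset.sum_congr rfl fun x _ => ?_
  rw [← addChar_map_sum, ← AddChar.map_add_eq_mul, ← AddChar.map_add_eq_mul,
    Finset.sum_add_distrib, ← Finset.mul_sum, dotProduct]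
  congr 1
  ring

theorem sum_addChar_dotProduct [DecidableEq F] [IsDomain R] {ψ : AddChar F R}
    (hψ : ψ.IsPrimitive) (k : Fin d → F) :
    ∑ x, ψ (k ⬝ᵥ x) = if k = 0 then (Fintype.card F : R) ^ d else 0 := by
  have hsum (j : Fin d) : ∑ x, ψ (k j * x) = if k j = 0 then (Fintype.card F : R) else 0 := by
    simpa [mul_comm] using AddChar.sum_mulShift (k j) hψ
  simp only [sum_addChar_dotProduct_eq_prod, hsum]
  split_ifs with hk
  · simp [hk]
  · obtain ⟨j, hj⟩ := Function.ne_iff.mp hk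
    exact Finset.prod_eq_zero (Finset.mem_univ j) (if_neg hj)

variable [DecidableEq F]

/-- The sum of `ψ` over the square roots of `z`, which is the Fourier transform of a
one-dimensional sphere at the frequency `1`. -/
noncomputable def sqrtSum (ψ : AddChar F R) (z : F) : R := ∑ w with w ^ 2 = z, ψ w

theorem sphereFourier_one_dim (ψ : AddChar F R) (z : F) :
    sphereFourier ψ z (fun _ : Fin 1 => 1) = sqrtSum ψ z := by
  simp only [sphereFourier, radiusSphere, sqrtSum, Finset.sum_filter]
  rw [← (Equiv.funUnique (Fin 1) F).symm.sum_comp]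
  simp [dotProduct]

variable [IsDomain R] [CharZero R] {ψ : AddChar F R}

theorem card_mul_sphereFourier (hF : ringChar F ≠ 2) (hψ : ψ.IsPrimitive) (r : F)
    (k : Fin d → F) :
    (Fintype.card F : R) * sphereFourier ψ r k =
      (if k = 0 then (Fintype.card F : R) ^ d else 0) +
        gaussSum (quadraticMulChar F R) ψ ^ d *
          ∑ a with a ≠ 0, (quadraticMulChar F R a) ^ d * ψ (-(a * r) - (k ⬝ᵥ k) / (4 * a)) := by
  rw [card_mul_sphereFourier_eq_sum_prod hψ, ← Finset.add_sum_erase _ _ (Finset.mem_univ (0 : F)),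
    Finset.mul_sum, ← Finset.filter_ne']
  congr 1
  · simp [← sum_addChar_dotProduct hψ, sum_addChar_dotProduct_eq_prod]
  refine Finset.sum_congr rfl fun a ha => ?_
  simp only [sum_addChar_quadratic hF hψ (Finset.mem_filter.mp ha).2]
  rw [Finset.prod_mul_distrib, Finset.prod_const, Finset.card_univ, Fintype.card_fin, mul_pow,
    ← addChar_map_sum, sub_eq_add_neg, AddChar.map_add_eq_mul, Finset.sum_neg_distrib,
    ← Finset.sum_div]
  simp only [sq, dotProduct]
  ring

theorem card_mul_sphereFourier_of_odd (hF : ringChar F ≠ 2) (hψ : ψ.IsPrimitive) (hd : Odd d)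
    (r : F) (k : Fin d → F) :
    (Fintype.card F : R) * sphereFourier ψ r k =
      (if k = 0 then (Fintype.card F : R) ^ d else 0) +
        gaussSum (quadraticMulChar F R) ψ ^ d *
          ∑ a, quadraticMulChar F R a * ψ (-(a * r) - (k ⬝ᵥ k) / (4 * a)) := by
  have hpow (a : F) : quadraticMulChar F R a ^ d = quadraticMulChar F R a := by
    rw [← MulChar.pow_apply' _ hd.pos.ne', isQuadratic_quadraticMulChar.pow_odd hd]
  simp only [card_mul_sphereFourier hF hψ, hpow]
  rw [Finset.sum_filter_of_ne]
  rintro a - ha rfl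
  simp [MulChar.map_zero] at ha

theorem card_mul_sqrtSum (hF : ringChar F ≠ 2) (hψ : ψ.IsPrimitive) (r : F) {m : F}
    (hm : m ≠ 0) :
    (Fintype.card F : R) * sqrtSum ψ (m * r) =
      quadraticMulChar F R m * gaussSum (quadraticMulChar F R) ψ *
        ∑ a, quadraticMulChar F R a * ψ (-(a * r) - m / (4 * a)) := by
  have hscale (a : F) : quadraticMulChar F R (a * m⁻¹) *
      ψ (-(a * m⁻¹ * (m * r)) - 1 / (4 * (a * m⁻¹))) =
      quadraticMulChar F R m * (quadraticMulChar F R a * ψ (-(a * r) - m / (4 * a))) := by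
    rw [map_mul, ← MulChar.inv_apply', isQuadratic_quadraticMulChar.inv, mul_assoc a,
      inv_mul_cancel_left₀ hm, one_div, mul_inv, mul_inv, inv_inv, div_eq_mul_inv, mul_inv]
    ring_nf
  rw [← sphereFourier_one_dim, card_mul_sphereFourier_of_odd hF hψ odd_one,
    if_neg (Function.ne_iff.mpr ⟨0, one_ne_zero⟩), zero_add, pow_one,
    ← Equiv.sum_comp (Equiv.mulRight₀ m⁻¹ (inv_ne_zero hm))]
  simp only [dotProduct, Finset.univ_unique, Finset.sum_singleton, mul_one,
    Equiv.mulRight₀_apply, hscale, ← Finset.mul_sum]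
  ring

theorem sphereFourier_eq_mul_sqrtSum (hF : ringChar F ≠ 2) (hψ : ψ.IsPrimitive) (hd : Odd d)
    (r : F) {k : Fin d → F} (hk : k ⬝ᵥ k ≠ 0) :
    sphereFourier ψ r k = quadraticMulChar F R (k ⬝ᵥ k) *
      gaussSum (quadraticMulChar F R) ψ ^ (d - 1) * sqrtSum ψ ((k ⬝ᵥ k) * r) := by
  have hk0 : k ≠ 0 := by rintro rfl; simp at hk
  have hχ : quadraticMulChar F R (k ⬝ᵥ k) ^ 2 = 1 := by
    rw [← MulChar.pow_apply' _ two_ne_zero, isQuadratic_quadraticMulChar.sq_eq_one,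
      MulChar.one_apply (isUnit_iff_ne_zero.mpr hk)]
  have hsphere := card_mul_sphereFourier_of_odd hF hψ hd r k
  have hsqrt := card_mul_sqrtSum hF hψ r hk
  rw [if_neg hk0, zero_add, ← mul_pow_sub_one hd.pos.ne'] at hsphere
  apply mul_left_cancel₀ (Nat.cast_ne_zero.mpr Fintype.card_ne_zero : (Fintype.card F : R) ≠ 0)
  linear_combination hsphere -
    quadraticMulChar F R (k ⬝ᵥ k) * gaussSum (quadraticMulChar F R) ψ ^ (d - 1) * hsqrt -
    gaussSum (quadraticMulChar F R) ψ ^ (d - 1) * gaussSum (quadraticMulChar F R) ψ *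
      (∑ a, quadraticMulChar F R a * ψ (-(a * r) - (k ⬝ᵥ k) / (4 * a))) * hχ

theorem card_mul_card_radiusSphere (hF : ringChar F ≠ 2) (hψ : ψ.IsPrimitive) (hd : Odd d)
    (r : F) :
    (Fintype.card F : R) * (radiusSphere d r).card = (Fintype.card F : R) ^ d +
      quadraticMulChar F R (-r) * gaussSum (quadraticMulChar F R) ψ ^ (d + 1) := by
  have h := card_mul_sphereFourier_of_odd hF hψ hd r 0
  have hlinear := sum_quadraticMulChar_mul_addChar hF ψ (-r)
  simp only [sphereFourier_zero, if_true, dotProduct_zero, zero_div, sub_zero] at h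
  simp only [neg_mul, mul_comm r] at hlinear
  rw [h, hlinear]
  ring

theorem norm_sphereFourier_sq {ψ : AddChar F ℂ} (hF : ringChar F ≠ 2) (hψ : ψ.IsPrimitive)
    (hd : Odd d) (r : F) {k : Fin d → F} (hk : k ⬝ᵥ k ≠ 0) :
    ‖sphereFourier ψ r k‖ ^ 2 =
      (Fintype.card F : ℝ) ^ (d - 1) * ‖sqrtSum ψ ((k ⬝ᵥ k) * r)‖ ^ 2 := by
  rw [sphereFourier_eq_mul_sqrtSum hF hψ hd r hk, norm_mul, norm_mul, norm_quadraticMulChar hk,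
    one_mul, mul_pow, norm_pow, pow_right_comm,
    norm_gaussSum_sq (quadraticMulChar_ne_one hF) hψ]

end SphereFourier

/-! ## Unitary matrices -/

section Unitaries

open scoped Matrix

variable {ι : Type*} [Fintype ι]

theorem mul_vecMulVec_star_mul_conjTranspose_apply_self (M : Matrix ι ι ℂ) (v : ι → ℂ) (i : ι) :
    (M * Matrix.vecMulVec v (star v) * Mᴴ) i i = (‖(M *ᵥ v) i‖ ^ 2 : ℝ) := by
  rw [Matrix.mul_vecMulVec, Matrix.vecMulVec_mul, Matrix.vecMulVec_apply, ← Matrix.star_mulVec,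
    Pi.star_apply, Complex.star_def, Complex.mul_conj, Complex.normSq_eq_norm_sq]

theorem kronecker_one_mulVec_apply {κ : Type*} [Fintype κ] [DecidableEq κ]
    (M : Matrix ι ι ℂ) (v : ι × κ → ℂ) (z : ι × κ) :
    (Matrix.kronecker M (1 : Matrix κ κ ℂ) *ᵥ v) z = (M *ᵥ fun i => v (i, z.2)) z.1 := by
  simp [Matrix.mulVec, dotProduct, Fintype.sum_prod_type, Matrix.kroneckerMap_apply,
    Matrix.one_apply]

variable [DecidableEq ι]

theorem sum_norm_mulVec_sq {U : Matrix ι ι ℂ} (hU : U ∈ Matrix.unitaryGroup ι ℂ) (v : ι → ℂ) :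
    ∑ i, ‖(U *ᵥ v) i‖ ^ 2 = ∑ i, ‖v i‖ ^ 2 := by
  have hdot (w : ι → ℂ) : ((∑ i, ‖w i‖ ^ 2 : ℝ) : ℂ) = star w ⬝ᵥ w := by
    simp [dotProduct, Complex.conj_mul']
  apply Complex.ofReal_injective
  rw [hdot, hdot, Matrix.star_mulVec, Matrix.dotProduct_mulVec, Matrix.vecMul_vecMul,
    ← Matrix.star_eq_conjTranspose, Matrix.mem_unitaryGroup_iff'.mp hU, Matrix.vecMul_one]

/-- The unitary that permutes the computational basis. -/
def permUnitary (e : Equiv.Perm ι) : Matrix.unitaryGroup ι ℂ :=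
  ⟨e.permMatrix ℂ, by
    rw [Matrix.mem_unitaryGroup_iff, Matrix.star_eq_conjTranspose, Matrix.conjTranspose_permMatrix,
      ← Matrix.permMatrix_mul, inv_mul_cancel, Matrix.permMatrix_one]⟩

theorem permUnitary_mulVec (e : Equiv.Perm ι) (v : ι → ℂ) : (permUnitary e).1 *ᵥ v = v ∘ e :=
  Matrix.permMatrix_mulVec e

theorem exists_unitary_mulVec_single (i : ι) {v : ι → ℂ} (hv : ∑ j, ‖v j‖ ^ 2 = 1) :
    ∃ U : Matrix.unitaryGroup ι ℂ, U.1 *ᵥ Pi.single i 1 = v := by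
  have horth : Orthonormal ℂ
      (Set.domRestrict {i} fun _ : ι => (WithLp.toLp 2 v : EuclideanSpace ℂ ι)) := by
    refine ⟨fun _ => ?_, fun a b hab => (hab (Subsingleton.elim a b)).elim⟩
    rw [Set.domRestrict_apply, EuclideanSpace.norm_eq, Real.sqrt_eq_one]
    exact hv
  obtain ⟨b, hb⟩ := horth.exists_orthonormalBasis_extension_of_card_eq (by simp)
  refine ⟨⟨(EuclideanSpace.basisFun ι ℂ).toBasis.toMatrix b,
    OrthonormalBasis.toMatrix_orthonormalBasis_mem_unitary _ _⟩, ?_⟩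
  ext j
  rw [Matrix.mulVec_single_one]
  simp [Module.Basis.toMatrix, hb i rfl]

variable {κ : Type*} [Fintype κ] [DecidableEq κ]

/-- The unitary acting on the first factor of a bipartite system. -/
def kroneckerOne (κ : Type*) [Fintype κ] [DecidableEq κ] (U : Matrix.unitaryGroup ι ℂ) :
    Matrix.unitaryGroup (ι × κ) ℂ :=
  ⟨Matrix.kronecker U.1 1, Matrix.kronecker_mem_unitary U.2 (one_mem _)⟩

/-- A unitary transported along a renaming of the computational basis. -/
def reindexUnitary (e : κ ≃ ι) (U : Matrix.unitaryGroup ι ℂ) : Matrix.unitaryGroup κ ℂ :=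
  ⟨U.1.submatrix e e, by
    rw [Matrix.mem_unitaryGroup_iff, Matrix.star_eq_conjTranspose, Matrix.conjTranspose_submatrix,
      Matrix.submatrix_mul_equiv, ← Matrix.star_eq_conjTranspose,
      Matrix.mem_unitaryGroup_iff.mp U.2, Matrix.submatrix_one_equiv]⟩

theorem reindexUnitary_mulVec_comp (e : κ ≃ ι) (U : Matrix.unitaryGroup ι ℂ) (v : ι → ℂ) :
    (reindexUnitary e U).1 *ᵥ (v ∘ e) = (U.1 *ᵥ v) ∘ e := by
  rw [reindexUnitary, Matrix.submatrix_mulVec_equiv, Function.comp_assoc, e.self_comp_symm,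
    Function.comp_id]

end Unitaries

/-! ## The Fourier sampling distribution -/

section FourierSamplingDistribution

open scoped Matrix

variable {F : Type} [Field F] [Fintype F] {d : ℕ}

variable (F) in
/-- `traceChar` as an additive character. -/
noncomputable def traceAddChar : AddChar F ℂ :=
  letI : Algebra (ZMod (ringChar F)) F := ZMod.algebra F (ringChar F)
  haveI : NeZero (ringChar F) := ⟨CharP.ringChar_ne_zero_of_finite F⟩
  ZMod.stdAddChar.compAddMonoidHom (Algebra.trace (ZMod (ringChar F)) F).toAddMonoidHom

theorem traceChar_eq (a : F) : traceChar a = traceAddChar F a := by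
  let : Algebra (ZMod (ringChar F)) F := ZMod.algebra F (ringChar F)
  have : NeZero (ringChar F) := ⟨CharP.ringChar_ne_zero_of_finite F⟩
  have hexp (z : ZMod (ringChar F)) : ZMod.stdAddChar z =
      Complex.exp (2 * Real.pi * Complex.I * (z.val : ℂ) / (ringChar F : ℂ)) := by
    simpa using ZMod.stdAddChar_coe (N := ringChar F) (z.val : ℤ)
  exact (hexp _).symm

theorem isPrimitive_traceAddChar : (traceAddChar F).IsPrimitive := by
  let : Algebra (ZMod (ringChar F)) F := ZMod.algebra F (ringChar F)
  have : NeZero (ringChar F) := ⟨CharP.ringChar_ne_zero_of_finite F⟩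
  obtain ⟨a, ha⟩ := FiniteField.trace_to_zmod_nondegenerate F (one_ne_zero (α := F))
  rw [one_mul] at ha
  refine AddChar.IsPrimitive.of_ne_one (AddChar.ne_one_iff.mpr ⟨a, fun h => ha ?_⟩)
  exact ZMod.injective_stdAddChar (h.trans (AddChar.map_zero_eq_one _).symm)

theorem fourierMatrix_mem_unitaryGroup [DecidableEq F] :
    fourierMatrix F d ∈ Matrix.unitaryGroup (Fin d → F) ℂ := by
  rw [Matrix.mem_unitaryGroup_iff]
  ext k k'
  have hentry (x : Fin d → F) : fourierMatrix F d k x * (star (fourierMatrix F d)) x k' =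
      (1 / (Fintype.card F : ℂ) ^ d) * traceAddChar F ((k - k') ⬝ᵥ x) := by
    rw [Matrix.star_apply, fourierMatrix, Matrix.of_apply, Matrix.of_apply, traceChar_eq,
      traceChar_eq, Complex.star_def, map_mul, Complex.conj_ofReal, ← AddChar.map_neg_eq_conj,
      mul_mul_mul_comm, ← Complex.ofReal_mul, ← AddChar.map_add_eq_mul, div_mul_div_comm, one_mul,
      Real.mul_self_sqrt (by positivity), sub_dotProduct, sub_eq_add_neg]
    push_cast
    rfl
  simp only [Matrix.mul_apply, hentry]
  rw [← Finset.mul_sum, sum_addChar_dotProduct isPrimitive_traceAddChar, Matrix.one_apply]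
  simp [sub_eq_zero]

theorem fourierMatrix_mulVec_sphereState (r : F) (t k : Fin d → F) :
    (fourierMatrix F d *ᵥ sphereState r t) k =
      ((1 / √((Fintype.card F : ℝ) ^ d) * (1 / √(radiusSphere d r).card) : ℝ) : ℂ) *
        (traceAddChar F (k ⬝ᵥ t) * sphereFourier (traceAddChar F) r k) := by
  classical
  rw [Matrix.mulVec, dotProduct, ← Equiv.sum_comp (Equiv.addRight t)]
  simp only [Equiv.coe_addRight, sphereState, add_sub_cancel_right, mul_ite, mul_zero]
  rw [← Finset.sum_filter, Finset.filter_mem_eq_inter, Finset.univ_inter, sphereFourier,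
    Finset.mul_sum, Finset.mul_sum]
  refine Finset.sum_congr rfl fun x _ => ?_
  rw [fourierMatrix, Matrix.of_apply, traceChar_eq, dotProduct_add, AddChar.map_add_eq_mul]
  push_cast
  ring

theorem norm_fourierMatrix_mulVec_sphereState_sq (r : F) (t k : Fin d → F) :
    ‖(fourierMatrix F d *ᵥ sphereState r t) k‖ ^ 2 =
      ‖sphereFourier (traceAddChar F) r k‖ ^ 2 /
        ((Fintype.card F : ℝ) ^ d * (radiusSphere d r).card) := by
  rw [fourierMatrix_mulVec_sphereState, norm_mul, norm_mul, AddChar.norm_apply, Complex.norm_real,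
    Real.norm_eq_abs, one_mul, mul_pow, sq_abs, mul_pow, div_pow, div_pow,
    Real.sq_sqrt (by positivity), Real.sq_sqrt (by positivity)]
  ring

theorem fourierProb_eq_norm_mulVec_sq (r : F) (t k : Fin d → F) :
    fourierProb r k = ‖(fourierMatrix F d *ᵥ sphereState r t) k‖ ^ 2 := by
  have hcenter (t' : Fin d → F) : ‖(fourierMatrix F d *ᵥ sphereState r t') k‖ ^ 2 =
      ‖(fourierMatrix F d *ᵥ sphereState r t) k‖ ^ 2 := by
    rw [norm_fourierMatrix_mulVec_sphereState_sq, norm_fourierMatrix_mulVec_sphereState_sq]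
  have hq : (Fintype.card F : ℂ) ^ d ≠ 0 := by simp
  rw [fourierProb, hiddenRadiusState, Matrix.mul_smul, Matrix.smul_mul, Matrix.smul_apply,
    Finset.mul_sum, Finset.sum_mul, Matrix.sum_apply]
  simp only [mul_vecMulVec_star_mul_conjTranspose_apply_self, hcenter]
  rw [Finset.sum_const, Finset.card_univ, Fintype.card_pi, Finset.prod_const, Finset.card_univ,
    Fintype.card_fin, nsmul_eq_mul, Nat.cast_pow, smul_eq_mul, one_div, inv_mul_cancel_left₀ hq,
    Complex.ofReal_re]

theorem fourierProb_eq_norm_sphereFourier_sq (r : F) (k : Fin d → F) :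
    fourierProb r k = ‖sphereFourier (traceAddChar F) r k‖ ^ 2 /
      ((Fintype.card F : ℝ) ^ d * (radiusSphere d r).card) := by
  rw [fourierProb_eq_norm_mulVec_sq r 0 k, norm_fourierMatrix_mulVec_sphereState_sq]

theorem fourierProb_nonneg (r : F) (k : Fin d → F) : 0 ≤ fourierProb r k := by
  rw [fourierProb_eq_norm_mulVec_sq r 0 k]
  positivity

theorem sum_norm_sphereState_sq {r : F} (h : (radiusSphere d r).Nonempty) (t : Fin d → F) :
    ∑ x, ‖sphereState r t x‖ ^ 2 = 1 := by
  classical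
  have hcard : ((radiusSphere d r).card : ℝ) ≠ 0 := Nat.cast_ne_zero.mpr h.card_ne_zero
  rw [← Equiv.sum_comp (Equiv.addRight t)]
  simp only [Equiv.coe_addRight, sphereState, add_sub_cancel_right, apply_ite norm, norm_zero,
    ite_pow, Complex.norm_real, Real.norm_eq_abs, sq_abs, div_pow, one_pow, ne_eq,
    OfNat.ofNat_ne_zero, not_false_eq_true, zero_pow, Real.sq_sqrt (Nat.cast_nonneg _)]
  rw [← Finset.sum_filter, Finset.filter_mem_eq_inter, Finset.univ_inter, Finset.sum_const,
    nsmul_eq_mul, mul_one_div_cancel hcard]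

theorem sum_fourierProb {r : F} (h : (radiusSphere d r).Nonempty) :
    ∑ k : Fin d → F, fourierProb r k = 1 := by
  classical
  simp only [fourierProb_eq_norm_mulVec_sq r 0]
  rw [sum_norm_mulVec_sq fourierMatrix_mem_unitaryGroup, sum_norm_sphereState_sq h]

end FourierSamplingDistribution

/-! ## Total variation distances -/

section RealParts

theorem two_mul_re_addChar_mul_re {G : Type*} [AddCommGroup G] [Finite G] (ψ : AddChar G ℂ)
    (u v : G) : 2 * ((ψ u).re * (ψ v).re) = (ψ (u + v)).re + (ψ (u - v)).re := by
  rw [sub_eq_add_neg, AddChar.map_add_eq_mul, AddChar.map_add_eq_mul, AddChar.map_neg_eq_conj]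
  simp only [Complex.mul_re, Complex.conj_re, Complex.conj_im]
  ring

theorem abs_re_addChar_le_one {G : Type*} [AddCommGroup G] [Finite G] (ψ : AddChar G ℂ) (a : G) :
    |(ψ a).re| ≤ 1 :=
  (Complex.abs_re_le_norm _).trans (AddChar.norm_apply ψ a).le

variable {F : Type*} [Field F] [Fintype F] {ψ : AddChar F ℂ}

section

variable [DecidableEq F]

theorem sum_re_addChar_mul (hψ : ψ.IsPrimitive) (a : F) :
    ∑ u, (ψ (a * u)).re = if a = 0 then (Fintype.card F : ℝ) else 0 := by
  rw [← Complex.re_sum]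
  simp only [mul_comm a, AddChar.sum_mulShift a hψ]
  split_ifs <;> simp

theorem sum_re_addChar_mul_re (hψ : ψ.IsPrimitive) (a b : F) :
    ∑ u, (ψ (a * u)).re * (ψ (b * u)).re =
      ((if a + b = 0 then (Fintype.card F : ℝ) else 0) +
        (if a - b = 0 then (Fintype.card F : ℝ) else 0)) / 2 := by
  rw [← sum_re_addChar_mul hψ, ← sum_re_addChar_mul hψ, eq_div_iff two_ne_zero, mul_comm,
    Finset.mul_sum, ← Finset.sum_add_distrib]
  simp only [two_mul_re_addChar_mul_re, add_mul, sub_mul]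

end

theorem sum_re_addChar_sq (hF : ringChar F ≠ 2) (hψ : ψ.IsPrimitive) {a : F} (ha : a ≠ 0) :
    ∑ u, (ψ (a * u)).re ^ 2 = (Fintype.card F : ℝ) / 2 := by
  classical
  have ha2 : a + a ≠ 0 := by simpa [← two_mul, ha] using Ring.two_ne_zero hF
  simp only [sq, sum_re_addChar_mul_re hψ, if_neg ha2, sub_self, if_true, zero_add]

theorem sum_re_addChar_sub_sq (hF : ringChar F ≠ 2) (hψ : ψ.IsPrimitive) {a b : F} (ha : a ≠ 0)
    (hb : b ≠ 0) (hadd : a + b ≠ 0) (hsub : a - b ≠ 0) :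
    ∑ u, ((ψ (a * u)).re - (ψ (b * u)).re) ^ 2 = Fintype.card F := by
  classical
  simp only [sub_sq, mul_assoc (2 : ℝ)]
  rw [Finset.sum_add_distrib, Finset.sum_sub_distrib, ← Finset.mul_sum, sum_re_addChar_sq hF hψ ha,
    sum_re_addChar_sq hF hψ hb, sum_re_addChar_mul_re hψ, if_neg hadd, if_neg hsub]
  ring

variable [DecidableEq F]

theorem sum_erase_zero_re_addChar (hψ : ψ.IsPrimitive) {a : F} (ha : a ≠ 0) :
    ∑ u ∈ Finset.univ.erase 0, (ψ (a * u)).re = -1 := by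
  rw [Finset.sum_erase_eq_sub (Finset.mem_univ 0), sum_re_addChar_mul hψ, if_neg ha]
  simp

theorem sum_erase_zero_re_addChar_sq (hF : ringChar F ≠ 2) (hψ : ψ.IsPrimitive) {a : F}
    (ha : a ≠ 0) :
    ∑ u ∈ Finset.univ.erase 0, (ψ (a * u)).re ^ 2 = (Fintype.card F : ℝ) / 2 - 1 := by
  rw [Finset.sum_erase_eq_sub (Finset.mem_univ 0), sum_re_addChar_sq hF hψ ha]
  simp

end RealParts

section SqrtSum

variable {F : Type} [Field F] [Fintype F] [DecidableEq F] {R : Type*} [CommRing R]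

theorem sqrtSum_zero (ψ : AddChar F R) : sqrtSum ψ 0 = 1 := by
  simp [sqrtSum, Finset.filter_eq']

theorem sqrtSum_of_not_isSquare (ψ : AddChar F R) {z : F} (hz : ¬ IsSquare z) :
    sqrtSum ψ z = 0 := by
  refine Finset.sum_eq_zero fun w hw => (hz ⟨w, ?_⟩).elim
  rw [← sq, (Finset.mem_filter.mp hw).2]

theorem norm_sqrtSum_sq_sq (hF : ringChar F ≠ 2) (ψ : AddChar F ℂ) {v : F} (hv : v ≠ 0) :
    ‖sqrtSum ψ (v ^ 2)‖ ^ 2 = 2 + 2 * (ψ (2 * v)).re := by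
  have hne : v ≠ -v := fun h => hv (by simpa [Ring.two_ne_zero hF] using
    (by linear_combination h : 2 * v = 0))
  have hroots : (Finset.univ.filter fun w : F => w ^ 2 = v ^ 2) = {v, -v} := by
    ext w
    simp [sq_eq_sq_iff_eq_or_eq_neg]
  have hdouble := two_mul_re_addChar_mul_re ψ v v
  rw [sub_self, AddChar.map_zero_eq_one, Complex.one_re, ← two_mul] at hdouble
  rw [sqrtSum, hroots, Finset.sum_pair hne, AddChar.map_neg_eq_conj, Complex.add_conj,
    Complex.norm_real, Real.norm_eq_abs, sq_abs]
  linarith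

end SqrtSum

section SphereCardinality

variable {F : Type} [Field F] [Fintype F] {d : ℕ}

theorem ringChar_ne_two_of_odd_card (hq : Odd (Fintype.card F)) : ringChar F ≠ 2 := fun h =>
  Nat.not_even_iff_odd.mpr hq (Nat.even_iff.mpr (FiniteField.even_card_of_char_two h))

theorem three_le_card_of_odd_card (hq : Odd (Fintype.card F)) : 3 ≤ Fintype.card F := by
  have := Fintype.one_lt_card (α := F)
  obtain ⟨e, he⟩ := hq
  omega

theorem card_radiusSphere_zero (hF : ringChar F ≠ 2) (hd : Odd d) :
    (radiusSphere d (0 : F)).card = Fintype.card F ^ (d - 1) := by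
  classical
  have h := card_mul_card_radiusSphere hF isPrimitive_traceAddChar hd (0 : F)
  rw [neg_zero, MulChar.map_zero, zero_mul, add_zero, ← mul_pow_sub_one hd.pos.ne'] at h
  exact_mod_cast mul_left_cancel₀ (by simp) h

theorem card_radiusSphere_sub_sq (hF : ringChar F ≠ 2) (hd : Odd d) {r : F} (hr : r ≠ 0) :
    (((radiusSphere d r).card : ℝ) - (Fintype.card F : ℝ) ^ (d - 1)) ^ 2 =
      (Fintype.card F : ℝ) ^ (d - 1) := by
  classical
  have hsub : (((Fintype.card F : ℝ) *
      ((radiusSphere d r).card - (Fintype.card F : ℝ) ^ (d - 1)) : ℝ) : ℂ) =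
      quadraticMulChar F ℂ (-r) * gaussSum (quadraticMulChar F ℂ) (traceAddChar F) ^ (d + 1) := by
    push_cast
    rw [mul_sub, mul_pow_sub_one hd.pos.ne',
      card_mul_card_radiusSphere hF isPrimitive_traceAddChar hd, add_sub_cancel_left]
  have hnorm := congrArg (‖·‖ ^ 2) hsub
  simp only [norm_mul, norm_pow, norm_quadraticMulChar (neg_ne_zero.mpr hr), one_mul,
    Complex.norm_real, Real.norm_eq_abs] at hnorm
  rw [← pow_mul, mul_comm (d + 1), pow_mul, norm_gaussSum_sq (quadraticMulChar_ne_one hF)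
    isPrimitive_traceAddChar, mul_pow, sq_abs, sq_abs] at hnorm
  apply mul_left_cancel₀ (pow_ne_zero 2 (by simp) : (Fintype.card F : ℝ) ^ 2 ≠ 0)
  rw [hnorm, ← pow_add]
  congr 1
  have := hd.pos
  omega

theorem card_radiusSphere_one (hF : ringChar F ≠ 2) {r : F} (hr : r ≠ 0)
    (h : (radiusSphere 1 r).Nonempty) : (radiusSphere 1 r).card = 2 := by
  have hsq := card_radiusSphere_sub_sq hF odd_one hr
  rw [Nat.sub_self, pow_zero] at hsq
  have hpos : ((radiusSphere 1 r).card : ℝ) ≠ 0 := Nat.cast_ne_zero.mpr h.card_ne_zero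
  have htwo : ((radiusSphere 1 r).card : ℝ) = 2 :=
    mul_left_cancel₀ hpos (by linear_combination hsq)
  exact_mod_cast htwo

theorem card_radiusSphere_ge (hq : Odd (Fintype.card F)) (hd : Odd d) (hd3 : 3 ≤ d) (r : F) :
    2 / 3 * (Fintype.card F : ℝ) ^ (d - 1) ≤ (radiusSphere d r).card := by
  have hF := ringChar_ne_two_of_odd_card hq
  have hq3 : (3 : ℝ) ≤ Fintype.card F := by exact_mod_cast three_le_card_of_odd_card hq
  have hpow : (9 : ℝ) ≤ (Fintype.card F : ℝ) ^ (d - 1) :=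
    calc (9 : ℝ) = 3 ^ 2 := by norm_num
      _ ≤ (Fintype.card F : ℝ) ^ 2 := by gcongr
      _ ≤ _ := pow_le_pow_right₀ (by linarith) (by omega)
  rcases eq_or_ne r 0 with rfl | hr
  · rw [card_radiusSphere_zero hF hd, Nat.cast_pow]
    linarith
  · have hdev : |((radiusSphere d r).card : ℝ) - (Fintype.card F : ℝ) ^ (d - 1)| ≤
        1 / 3 * (Fintype.card F : ℝ) ^ (d - 1) := by
      apply abs_le_of_sq_le_sq _ (by positivity)
      rw [card_radiusSphere_sub_sq hF hd hr]
      nlinarith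
    linarith [(abs_le.mp hdev).1]

theorem card_radiusSphere_ge_of_nonempty (hq : Odd (Fintype.card F)) (hd : Odd d) {r : F}
    (h : (radiusSphere d r).Nonempty) :
    2 / 3 * (Fintype.card F : ℝ) ^ (d - 1) ≤ (radiusSphere d r).card := by
  obtain rfl | hd3 : d = 1 ∨ 3 ≤ d := by obtain ⟨e, rfl⟩ := hd; omega
  · have : (1 : ℝ) ≤ (radiusSphere 1 r).card := by exact_mod_cast h.card_pos
    rw [Nat.sub_self, pow_zero]
    linarith
  · exact card_radiusSphere_ge hq hd hd3 r

theorem card_radiusSphere_mul_sq (r : F) {u : F} (hu : u ≠ 0) :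
    (radiusSphere d (r * u ^ 2)).card = (radiusSphere d r).card := by
  refine (Finset.card_equiv (DistribMulAction.toAddEquiv _ (Units.mk0 u hu)).toEquiv
    fun x => ?_).symm
  simp [mem_radiusSphere, Units.smul_def, mul_pow, ← Finset.mul_sum, mul_comm _ (u ^ 2), hu]

end SphereCardinality

section TotalVariation

variable {F : Type} [Field F] [Fintype F] {d : ℕ}

theorem fourierTV_comm (r r' : F) : fourierTV d r r' = fourierTV d r' r := by
  simp only [fourierTV, abs_sub_comm]

theorem sum_comp_dotProduct_self (f : F → ℝ) :
    ∑ k : Fin d → F, f (k ⬝ᵥ k) = ∑ m, (radiusSphere d m).card * f m := by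
  classical
  rw [← Finset.sum_fiberwise Finset.univ (fun k : Fin d → F => k ⬝ᵥ k)]
  refine Finset.sum_congr rfl fun m _ => ?_
  have hfiber : (Finset.univ.filter fun k : Fin d → F => k ⬝ᵥ k = m) = radiusSphere d m := by
    ext k
    rw [Finset.mem_filter_univ, mem_radiusSphere]
    simp only [dotProduct, sq]
  rw [hfiber, ← nsmul_eq_mul, ← Finset.sum_const]
  refine Finset.sum_congr rfl fun k hk => ?_
  rw [dotProduct, ← mem_radiusSphere.mp hk]
  simp only [sq]

section

variable [DecidableEq F]

theorem sum_erase_zero_comp_mul_sq_le (hF : ringChar F ≠ 2) {r : F} (hr : r ≠ 0) {g : F → ℝ}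
    (hg : ∀ m, 0 ≤ g m) :
    ∑ u ∈ Finset.univ.erase 0, g (r * u ^ 2) ≤ 2 * ∑ m ∈ Finset.univ.erase 0, g m := by
  let h : F → ℝ := fun m => if m = 0 then 0 else g m
  have hh : ∀ m, 0 ≤ h m := fun m => by
    dsimp only [h]
    split_ifs <;> simp [hg]
  have hsum (f : F → F) (hf : ∀ u, f u = 0 ↔ u = 0) :
      ∑ u, h (f u) = ∑ u ∈ Finset.univ.erase 0, g (f u) := by
    rw [← Finset.sum_erase Finset.univ (a := 0) (f := fun u => h (f u)) (if_pos ((hf 0).mpr rfl))]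
    exact Finset.sum_congr rfl fun u hu => if_neg ((hf u).not.mpr (Finset.ne_of_mem_erase hu))
  have hχ (y : F) : quadraticMulChar F ℝ y + 1 ≤ 2 := by
    rcases isQuadratic_quadraticMulChar (R := ℝ) y with h | h | h <;> rw [h] <;> norm_num
  calc ∑ u ∈ Finset.univ.erase 0, g (r * u ^ 2) = ∑ u, h (r * u ^ 2) :=
        (hsum _ fun u => by simp [hr]).symm
    _ = ∑ y, (quadraticMulChar F ℝ y + 1) * h (r * y) := sum_comp_sq hF fun y => h (r * y)
    _ ≤ ∑ y, 2 * h (r * y) := by gcongr with y; exacts [hh _, hχ y]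
    _ = 2 * ∑ m, h m := by
        rw [← Finset.mul_sum, ← Equiv.sum_comp (Equiv.mulLeft₀ r hr) h]
        rfl
    _ = 2 * ∑ m ∈ Finset.univ.erase 0, g m := congrArg (2 * ·) (hsum id fun _ => Iff.rfl)

/-- The probability that Fourier sampling returns `k`, for any single frequency `k` with
`k ⬝ᵥ k = m`, where `m ≠ 0` and `d` is odd. -/
noncomputable def fourierLevelProb (d : ℕ) (r m : F) : ℝ :=
  ‖sqrtSum (traceAddChar F) (m * r)‖ ^ 2 / (Fintype.card F * (radiusSphere d r).card)

theorem fourierProb_eq_fourierLevelProb (hF : ringChar F ≠ 2) (hd : Odd d) (r : F) {k : Fin d → F}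
    (hk : k ⬝ᵥ k ≠ 0) : fourierProb r k = fourierLevelProb d r (k ⬝ᵥ k) := by
  rw [fourierProb_eq_norm_sphereFourier_sq, norm_sphereFourier_sq hF isPrimitive_traceAddChar hd r
    hk, fourierLevelProb, ← pow_sub_one_mul hd.pos.ne' (Fintype.card F : ℝ),
    mul_assoc (_ ^ (d - 1)), mul_div_mul_left _ _ (by simp)]

theorem sum_abs_fourierLevelProb_sub_le (hF : ringChar F ≠ 2) (hd : Odd d) (r r' : F) :
    ∑ m ∈ Finset.univ.erase 0,
      (radiusSphere d m).card * |fourierLevelProb d r m - fourierLevelProb d r' m| ≤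
      2 * fourierTV d r r' := by
  let f : F → ℝ := fun m =>
    if m = 0 then 0 else |fourierLevelProb d r m - fourierLevelProb d r' m|
  calc _ = ∑ m ∈ Finset.univ.erase 0, (radiusSphere d m).card * f m := by
        refine Finset.sum_congr rfl fun m hm => ?_
        dsimp only [f]
        rw [if_neg (Finset.ne_of_mem_erase hm)]
    _ = ∑ k : Fin d → F, f (k ⬝ᵥ k) := by
        rw [Finset.sum_erase _ (by simp [f]), sum_comp_dotProduct_self]
    _ ≤ ∑ k : Fin d → F, |fourierProb r k - fourierProb r' k| := by
        refine Finset.sum_le_sum fun k _ => ?_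
        dsimp only [f]
        split_ifs with hk
        · positivity
        · rw [fourierProb_eq_fourierLevelProb hF hd r hk,
            fourierProb_eq_fourierLevelProb hF hd r' hk]
    _ = 2 * fourierTV d r r' := by rw [fourierTV]; ring

theorem card_mul_fourierLevelProb_mul_sq (hF : ringChar F ≠ 2) {r : F} (hr : r ≠ 0)
    (h : (radiusSphere d r).Nonempty) {u : F} (hu : u ≠ 0) :
    Fintype.card F * ((radiusSphere d r).card * fourierLevelProb d r (r * u ^ 2)) =
      2 + 2 * (traceAddChar F (2 * r * u)).re := by
  have hN : ((radiusSphere d r).card : ℝ) ≠ 0 := Nat.cast_ne_zero.mpr h.card_ne_zero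
  have hq : (Fintype.card F : ℝ) ≠ 0 := by simp
  have hsq : r * u ^ 2 * r = (r * u) ^ 2 := by ring
  rw [fourierLevelProb, ← mul_assoc, mul_div_cancel₀ _ (mul_ne_zero hq hN), hsq,
    norm_sqrtSum_sq_sq hF _ (mul_ne_zero hr hu), mul_assoc]

theorem sum_le_fourierTV (hF : ringChar F ≠ 2) (hd : Odd d) {r : F} (r' : F) (hr : r ≠ 0)
    (h : (radiusSphere d r).Nonempty) :
    1 / (4 * Fintype.card F) * ∑ u ∈ Finset.univ.erase 0,
      |2 + 2 * (traceAddChar F (2 * r * u)).re -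
        (radiusSphere d r).card / (radiusSphere d r').card *
          ‖sqrtSum (traceAddChar F) (r * u ^ 2 * r')‖ ^ 2| ≤ fourierTV d r r' := by
  let g : F → ℝ := fun m =>
    (radiusSphere d m).card * |fourierLevelProb d r m - fourierLevelProb d r' m|
  have hterm : ∀ u ∈ Finset.univ.erase (0 : F), |2 + 2 * (traceAddChar F (2 * r * u)).re -
      (radiusSphere d r).card / (radiusSphere d r').card *
        ‖sqrtSum (traceAddChar F) (r * u ^ 2 * r')‖ ^ 2| = Fintype.card F * g (r * u ^ 2) := by
    intro u hu
    have hu : u ≠ 0 := Finset.ne_of_mem_erase hu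
    have hlevel' : (radiusSphere d r).card / (radiusSphere d r').card *
        ‖sqrtSum (traceAddChar F) (r * u ^ 2 * r')‖ ^ 2 =
        Fintype.card F * ((radiusSphere d r).card * fourierLevelProb d r' (r * u ^ 2)) := by
      rw [fourierLevelProb]
      field_simp
    rw [← card_mul_fourierLevelProb_mul_sq hF hr h hu, hlevel', ← mul_sub, ← mul_sub, abs_mul,
      abs_mul, Nat.abs_cast, Nat.abs_cast]
    dsimp only [g]
    rw [card_radiusSphere_mul_sq r hu]
  have hlevels := sum_erase_zero_comp_mul_sq_le (g := g) hF hr fun m => by positivity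
  rw [Finset.sum_congr rfl hterm, ← Finset.mul_sum, one_div_mul_eq_div, div_le_iff₀ (by positivity)]
  calc _ ≤ Fintype.card F * (2 * (2 * fourierTV d r r')) := by
        gcongr
        exact hlevels.trans (by gcongr; exact sum_abs_fourierLevelProb_sub_le hF hd r r')
    _ = fourierTV d r r' * (4 * Fintype.card F) := by ring

theorem exists_eq_mul_sq_of_quadraticChar_eq {r r' : F} (hr : r ≠ 0)
    (h : quadraticChar F r = quadraticChar F r') : ∃ t, t ≠ 0 ∧ r' = r * t ^ 2 := by
  have hr' : r' ≠ 0 := by rwa [ne_eq, ← quadraticChar_eq_zero_iff, ← h, quadraticChar_eq_zero_iff]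
  have hχ : quadraticChar F (r * r') = 1 := by rw [map_mul, ← h, ← sq, quadraticChar_sq_one hr]
  obtain ⟨v, hv⟩ := (quadraticChar_one_iff_isSquare (mul_ne_zero hr hr')).mp hχ
  refine ⟨v / r, div_ne_zero ?_ hr, ?_⟩
  · rintro rfl
    exact mul_ne_zero hr hr' (by simpa using hv)
  · field_simp
    linear_combination hv

theorem fourierTV_ge_of_quadraticChar_eq (hF : ringChar F ≠ 2) (hd : Odd d) {r r' : F}
    (h : (radiusSphere d r).Nonempty) (hne : r ≠ r')
    (hχ : quadraticChar F r = quadraticChar F r') : 1 / 4 ≤ fourierTV d r r' := by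
  have hr : r ≠ 0 := by
    rintro rfl
    rw [quadraticChar_zero, eq_comm, quadraticChar_eq_zero_iff] at hχ
    exact hne hχ.symm
  obtain ⟨t, ht, rfl⟩ := exists_eq_mul_sq_of_quadraticChar_eq hr hχ
  have hN : ((radiusSphere d r).card : ℝ) ≠ 0 := Nat.cast_ne_zero.mpr h.card_ne_zero
  let ψ := traceAddChar F
  have hterm : ∀ u ∈ Finset.univ.erase (0 : F),
      ((ψ (2 * r * u)).re - (ψ (2 * r * t * u)).re) ^ 2 ≤
      |2 + 2 * (ψ (2 * r * u)).re - (radiusSphere d r).card /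
        (radiusSphere d (r * t ^ 2)).card * ‖sqrtSum ψ (r * u ^ 2 * (r * t ^ 2))‖ ^ 2| := by
    intro u hu
    have hu : u ≠ 0 := Finset.ne_of_mem_erase hu
    have hsq : r * u ^ 2 * (r * t ^ 2) = (r * t * u) ^ 2 := by ring
    have hfac : 2 + 2 * (ψ (2 * r * u)).re - (2 + 2 * (ψ (2 * r * t * u)).re) =
      2 * ((ψ (2 * r * u)).re - (ψ (2 * r * t * u)).re) := by ring
    rw [card_radiusSphere_mul_sq r ht, div_self hN, one_mul, hsq,
      norm_sqrtSum_sq_sq hF ψ (mul_ne_zero (mul_ne_zero hr ht) hu), ← mul_assoc, ← mul_assoc, hfac,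
      abs_mul, ← sq_abs, sq, abs_two]
    gcongr
    linarith [abs_sub (ψ (2 * r * u)).re (ψ (2 * r * t * u)).re,
      abs_re_addChar_le_one ψ (2 * r * u), abs_re_addChar_le_one ψ (2 * r * t * u)]
  have h2r : 2 * r ≠ 0 := mul_ne_zero (Ring.two_ne_zero hF) hr
  have hneg : t ≠ -1 := by rintro rfl; simp at hne
  have hone : t ≠ 1 := by rintro rfl; simp at hne
  have hsum := sum_re_addChar_sub_sq hF isPrimitive_traceAddChar h2r (mul_ne_zero h2r ht)
    (fun h0 => hneg (mul_left_cancel₀ h2r (by linear_combination h0)))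
    (fun h0 => hone (mul_left_cancel₀ h2r (by linear_combination -h0)))
  calc (1 : ℝ) / 4 = 1 / (4 * Fintype.card F) *
        ∑ u ∈ Finset.univ.erase 0, ((ψ (2 * r * u)).re - (ψ (2 * r * t * u)).re) ^ 2 := by
        rw [Finset.sum_erase _ (by simp), hsum]
        field_simp
    _ ≤ _ := by gcongr with u hu; exact hterm u hu
    _ ≤ _ := sum_le_fourierTV hF hd (r * t ^ 2) hr h

theorem not_isSquare_mul_of_quadraticChar_ne {r r' : F} (hr : r ≠ 0) (hr' : r' ≠ 0)
    (hχ : quadraticChar F r ≠ quadraticChar F r') : ¬ IsSquare (r * r') := by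
  rw [← quadraticChar_one_iff_isSquare (mul_ne_zero hr hr'), map_mul]
  intro h
  rcases quadraticChar_dichotomy hr with h1 | h1 <;>
    rcases quadraticChar_dichotomy hr' with h2 | h2 <;> simp_all

theorem fourierTV_ge_of_quadraticChar_ne (hq : Odd (Fintype.card F)) (hd : Odd d) {r r' : F}
    (h : (radiusSphere d r).Nonempty) (hr : r ≠ 0) (hr' : r' ≠ 0)
    (hχ : quadraticChar F r ≠ quadraticChar F r') : 1 / 12 ≤ fourierTV d r r' := by
  have hF := ringChar_ne_two_of_odd_card hq
  have hq3 : (3 : ℝ) ≤ Fintype.card F := by exact_mod_cast three_le_card_of_odd_card hq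
  let ψ := traceAddChar F
  have hterm : ∀ u ∈ Finset.univ.erase (0 : F), 2 + 2 * (ψ (2 * r * u)).re ≤
      |2 + 2 * (ψ (2 * r * u)).re - (radiusSphere d r).card /
        (radiusSphere d r').card * ‖sqrtSum ψ (r * u ^ 2 * r')‖ ^ 2| := by
    intro u hu
    have hu : u ≠ 0 := Finset.ne_of_mem_erase hu
    have hru : quadraticChar F (r * u ^ 2) ≠ quadraticChar F r' := by
      rwa [map_mul, quadraticChar_sq_one' hu, mul_one]
    rw [sqrtSum_of_not_isSquare ψ (not_isSquare_mul_of_quadraticChar_ne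
      (mul_ne_zero hr (pow_ne_zero 2 hu)) hr' hru)]
    simpa using le_abs_self _
  have hsum : ∑ u ∈ Finset.univ.erase 0, (2 + 2 * (ψ (2 * r * u)).re) =
      2 * (Fintype.card F - 2) := by
    rw [Finset.sum_add_distrib, ← Finset.mul_sum, sum_erase_zero_re_addChar
      isPrimitive_traceAddChar (mul_ne_zero (Ring.two_ne_zero hF) hr), Finset.sum_const,
      Finset.card_erase_of_mem (Finset.mem_univ _), Finset.card_univ, nsmul_eq_mul,
      Nat.cast_sub Fintype.card_pos, Nat.cast_one]
    ring
  calc (1 : ℝ) / 12 ≤ 1 / (4 * Fintype.card F) * (2 * (Fintype.card F - 2)) := by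
        rw [div_mul_eq_mul_div, div_le_div_iff₀ (by norm_num) (by linarith)]
        linarith
    _ ≤ _ := by rw [← hsum]; gcongr with u hu; exact hterm u hu
    _ ≤ _ := sum_le_fourierTV hF hd r' hr h

theorem two_mul_card_nonsquare_add_one (hF : ringChar F ≠ 2) {r : F} (hr : r ≠ 0) :
    2 * (Finset.univ.filter fun m : F => quadraticChar F (m * r) = -1).card + 1 =
      Fintype.card F := by
  have hpoint (m : F) : quadraticChar F (m * r) =
      1 - (if m = 0 then 1 else 0) - 2 * if quadraticChar F (m * r) = -1 then 1 else 0 := by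
    rcases eq_or_ne m 0 with rfl | hm
    · simp
    · rcases quadraticChar_dichotomy (mul_ne_zero hm hr) with h | h <;> simp [h, hm]
  have hsum := quadraticChar_sum_zero hF
  rw [← Equiv.sum_comp (Equiv.mulRight₀ r hr)] at hsum
  change ∑ m, quadraticChar F (m * r) = 0 at hsum
  rw [Finset.sum_congr rfl fun m _ => hpoint m, Finset.sum_sub_distrib, Finset.sum_sub_distrib,
    ← Finset.mul_sum, Finset.sum_boole, Finset.sum_boole, Finset.filter_eq' Finset.univ (0 : F),
    if_pos (Finset.mem_univ _), Finset.card_singleton, Finset.sum_const, Finset.card_univ,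
    nsmul_eq_mul, mul_one] at hsum
  omega

theorem abs_fourierLevelProb_sub_zero_of_nonsquare (hF : ringChar F ≠ 2) (hd : Odd d) {r m : F}
    (hm : ¬ IsSquare (m * r)) :
    |fourierLevelProb d r m - fourierLevelProb d 0 m| = 1 / (Fintype.card F : ℝ) ^ d := by
  rw [fourierLevelProb, fourierLevelProb, sqrtSum_of_not_isSquare _ hm, mul_zero, sqrtSum_zero,
    card_radiusSphere_zero hF hd, Nat.cast_pow, mul_pow_sub_one hd.pos.ne']
  simp

end

theorem fourierTV_zero_ge_of_dim_one (hq : Odd (Fintype.card F)) {r : F}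
    (h : (radiusSphere 1 r).Nonempty) (hr : r ≠ 0) : 1 / 12 ≤ fourierTV 1 r 0 := by
  classical
  have hF := ringChar_ne_two_of_odd_card hq
  have hq3 : (3 : ℝ) ≤ Fintype.card F := by exact_mod_cast three_le_card_of_odd_card hq
  let ψ := traceAddChar F
  have hterm : ∀ u ∈ Finset.univ.erase (0 : F), 2 * (ψ (2 * r * u)).re ^ 2 ≤
      |2 + 2 * (ψ (2 * r * u)).re - (radiusSphere 1 r).card /
        (radiusSphere 1 (0 : F)).card * ‖sqrtSum ψ (r * u ^ 2 * 0)‖ ^ 2| := by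
    intro u _
    rw [card_radiusSphere_one hF hr h, card_radiusSphere_zero hF odd_one, mul_zero, sqrtSum_zero,
      ← sq_abs]
    have hle := pow_le_of_le_one (abs_nonneg _) (abs_re_addChar_le_one ψ (2 * r * u)) two_ne_zero
    norm_num [abs_mul] at hle ⊢
    exact hle
  calc (1 : ℝ) / 12 ≤ 1 / (4 * Fintype.card F) * (2 * (Fintype.card F / 2 - 1)) := by
        rw [div_mul_eq_mul_div, div_le_div_iff₀ (by norm_num) (by linarith)]
        linarith
    _ = 1 / (4 * Fintype.card F) * ∑ u ∈ Finset.univ.erase 0, 2 * (ψ (2 * r * u)).re ^ 2 := by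
        rw [← Finset.mul_sum, sum_erase_zero_re_addChar_sq hF isPrimitive_traceAddChar
          (mul_ne_zero (Ring.two_ne_zero hF) hr)]
    _ ≤ _ := by gcongr with u hu; exact hterm u hu
    _ ≤ _ := sum_le_fourierTV hF odd_one 0 hr h

theorem fourierTV_zero_ge_of_three_le (hq : Odd (Fintype.card F)) (hd : Odd d) (hd3 : 3 ≤ d) {r : F}
    (hr : r ≠ 0) : 1 / 12 ≤ fourierTV d r 0 := by
  classical
  have hF := ringChar_ne_two_of_odd_card hq
  have hq3 : (3 : ℝ) ≤ Fintype.card F := by exact_mod_cast three_le_card_of_odd_card hq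
  let S := Finset.univ.filter fun m : F => quadraticChar F (m * r) = -1
  have hS : 2 * (S.card : ℝ) + 1 = Fintype.card F := by
    exact_mod_cast two_mul_card_nonsquare_add_one hF hr
  have hterm : ∀ m ∈ S, 2 / (3 * (Fintype.card F : ℝ)) ≤
      (radiusSphere d m).card * |fourierLevelProb d r m - fourierLevelProb d 0 m| := by
    intro m hm
    rw [abs_fourierLevelProb_sub_zero_of_nonsquare hF hd
      (quadraticChar_neg_one_iff_not_isSquare.mp (Finset.mem_filter.mp hm).2)]
    calc 2 / (3 * (Fintype.card F : ℝ)) =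
          2 / 3 * (Fintype.card F : ℝ) ^ (d - 1) * (1 / (Fintype.card F : ℝ) ^ d) := by
          rw [← mul_pow_sub_one hd.pos.ne' (Fintype.card F : ℝ)]
          field_simp
      _ ≤ _ := by gcongr; exact card_radiusSphere_ge hq hd hd3 m
  have hsub : S ⊆ Finset.univ.erase 0 := by
    intro m hm
    rw [Finset.mem_erase]
    refine ⟨?_, Finset.mem_univ m⟩
    rintro rfl
    simp [S] at hm
  have hsum : S.card * (2 / (3 * (Fintype.card F : ℝ))) ≤ 2 * fourierTV d r 0 := by
    rw [← nsmul_eq_mul]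
    exact (Finset.card_nsmul_le_sum S _ _ hterm).trans
      ((Finset.sum_le_sum_of_subset_of_nonneg hsub fun m _ _ => by positivity).trans
        (sum_abs_fourierLevelProb_sub_le hF hd r 0))
  have hfrac : 2 / 9 ≤ S.card * (2 / (3 * (Fintype.card F : ℝ))) := by
    rw [mul_div_assoc', div_le_div_iff₀ (by norm_num) (by positivity)]
    linarith
  linarith

theorem fourierTV_zero_ge (hq : Odd (Fintype.card F)) (hd : Odd d) {r : F}
    (h : (radiusSphere d r).Nonempty) (hr : r ≠ 0) : 1 / 12 ≤ fourierTV d r 0 := by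
  obtain rfl | hd3 : d = 1 ∨ 3 ≤ d := by obtain ⟨e, rfl⟩ := hd; omega
  · exact fourierTV_zero_ge_of_dim_one hq h hr
  · exact fourierTV_zero_ge_of_three_le hq hd hd3 hr

theorem fourierTV_ge (hq : Odd (Fintype.card F)) (hd : Odd d) {r r' : F}
    (h : (radiusSphere d r).Nonempty) (h' : (radiusSphere d r').Nonempty) (hne : r ≠ r') :
    1 / 12 ≤ fourierTV d r r' := by
  classical
  rcases eq_or_ne r 0 with rfl | hr
  · rw [fourierTV_comm]
    exact fourierTV_zero_ge hq hd h' hne.symm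
  rcases eq_or_ne r' 0 with rfl | hr'
  · exact fourierTV_zero_ge hq hd h hr
  by_cases hχ : quadraticChar F r = quadraticChar F r'
  · exact le_trans (by norm_num)
      (fourierTV_ge_of_quadraticChar_eq (ringChar_ne_two_of_odd_card hq) hd h hne hχ)
  · exact fourierTV_ge_of_quadraticChar_ne hq hd h hr hr' hχ

end TotalVariation

/-! ## Measurements -/

section Measurement

variable {ι κ μ : Type*} [Fintype ι] [DecidableEq κ]

/-- The probability of the value `o` when `ψ` is measured in the computational basis and `f` is
applied to the outcome. -/
noncomputable def measurementProb (f : ι → κ) (ψ : ι → ℂ) (o : κ) : ℝ :=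
  ∑ i, if f i = o then ‖ψ i‖ ^ 2 else 0

theorem sum_measurementProb [Fintype κ] (f : ι → κ) (ψ : ι → ℂ) :
    ∑ o, measurementProb f ψ o = ∑ i, ‖ψ i‖ ^ 2 := by
  simp only [measurementProb]
  rw [Finset.sum_comm]
  simp

theorem measurementProb_comp [Fintype κ] [DecidableEq μ] (g : κ → μ) (f : ι → κ) (ψ : ι → ℂ)
    (v : μ) :
    measurementProb (g ∘ f) ψ v = ∑ o, if g o = v then measurementProb f ψ o else 0 := by
  simp only [measurementProb, ← Finset.sum_filter]
  rw [Finset.sum_comm' (t' := Finset.univ.filter fun i => g (f i) = v) (s' := fun i => {f i})]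
  · simp
  · simp only [Finset.mem_filter, Finset.mem_univ, true_and, Finset.mem_singleton]
    grind

theorem measurementProb_mul [Fintype μ] (φ : ι → ℂ) (f : μ → κ) (ψ : μ → ℂ) (o : κ) :
    measurementProb (f ∘ Prod.snd) (fun z : ι × μ => φ z.1 * ψ z.2) o =
      (∑ i, ‖φ i‖ ^ 2) * measurementProb f ψ o := by
  simp only [measurementProb, Fintype.sum_prod_type, Finset.sum_mul_sum, Function.comp_apply,
    norm_mul, mul_pow, mul_ite, mul_zero]

theorem measurementProb_prod {n : ℕ} (f : ι → κ) (ψ : Fin n → ι → ℂ) (o : Fin n → κ) :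
    measurementProb (fun (y : Fin n → ι) j => f (y j)) (fun y => ∏ j, ψ j (y j)) o =
      ∏ j, measurementProb f (ψ j) (o j) := by
  simp only [measurementProb]
  rw [Finset.prod_univ_sum, Fintype.piFinset_univ]
  refine Finset.sum_congr rfl fun y _ => ?_
  rw [Finset.prod_ite_zero]
  simp only [funext_iff, Finset.mem_univ, true_imp_iff, norm_prod, Finset.prod_pow]

theorem measurementProb_comp_equiv {ι' : Type*} [Fintype ι'] (e : ι' ≃ ι) (f : ι → κ) (ψ : ι → ℂ)
    (o : κ) : measurementProb (f ∘ e) (ψ ∘ e) o = measurementProb f ψ o :=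
  e.sum_comp fun i => if f i = o then ‖ψ i‖ ^ 2 else 0

end Measurement

/-! ## Parallel repetition -/

section QueryCircuit

open scoped Matrix

variable {F : Type} [Field F] [Fintype F] {d : ℕ} {A B : Type} [AddCommGroup A] [AddCommGroup B]
  {r : F} {W R : Type}

/-- The basis of the query registers with work space `W × R`, seen as that of a bipartite system
one part of which is `R`. -/
def regroupWork (F : Type) (d : ℕ) (A B W R : Type) :
    QReg F d A B (W × R) ≃ QReg F d A B W × R where
  toFun z := ((z.1, z.2.1, z.2.2.1, z.2.2.2.1), z.2.2.2.2)
  invFun z := (z.1.1, z.1.2.1, z.1.2.2.1, z.1.2.2.2, z.2)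

/-- The product of a state of the query registers with work space `W` and of a state of `R`. -/
def tensorState (φ : QReg F d A B W → ℂ) (χ : R → ℂ) : QReg F d A B (W × R) → ℂ :=
  (fun z => φ z.1 * χ z.2) ∘ regroupWork F d A B W R

theorem HiddenRadiusOracle.query_tensorState (O : HiddenRadiusOracle F d A B r) (κ : QueryKind)
    (φ : QReg F d A B W → ℂ) (χ : R → ℂ) :
    O.query κ (tensorState φ χ) = tensorState (O.query κ φ) χ := by
  cases κ <;> rfl

variable [Fintype A] [Fintype B] [Fintype W]

theorem HiddenRadiusOracle.sum_norm_query_sq (O : HiddenRadiusOracle F d A B r) (κ : QueryKind)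
    (ψ : QReg F d A B W → ℂ) : ∑ z, ‖O.query κ ψ z‖ ^ 2 = ∑ z, ‖ψ z‖ ^ 2 := by
  simp only [Fintype.sum_prod_type]
  refine Finset.sum_congr rfl fun x _ => ?_
  cases κ with
  | fwd =>
    exact Finset.sum_congr rfl fun a _ =>
      (Equiv.subRight (O.fwd x a)).sum_comp fun b => ∑ w, ‖ψ (x, a, b, w)‖ ^ 2
  | bwd =>
    rw [Finset.sum_comm, Finset.sum_comm (s := Finset.univ (α := A))]
    exact Finset.sum_congr rfl fun b _ =>
      (Equiv.subRight (O.bwd x b)).sum_comp fun a => ∑ w, ‖ψ (x, a, b, w)‖ ^ 2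

variable [DecidableEq F] [DecidableEq A] [DecidableEq B] [DecidableEq W]

/-- The part of a query algorithm between the preparation of a state and the measurement: a
sequence of queries, each followed by a unitary. -/
abbrev QueryCircuit (F : Type) [Fintype F] [DecidableEq F] (d : ℕ) (A B W : Type)
    [Fintype A] [DecidableEq A] [Fintype B] [DecidableEq B] [Fintype W] [DecidableEq W] : Type :=
  List (QueryKind × Matrix.unitaryGroup (QReg F d A B W) ℂ)

/-- The state produced by a circuit from the state `ψ`. -/
noncomputable def HiddenRadiusOracle.run (O : HiddenRadiusOracle F d A B r)
    (c : QueryCircuit F d A B W) (ψ : QReg F d A B W → ℂ) : QReg F d A B W → ℂ :=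
  c.foldl (fun ψ step => step.2.1 *ᵥ O.query step.1 ψ) ψ

theorem HiddenRadiusOracle.run_append (O : HiddenRadiusOracle F d A B r)
    (c c' : QueryCircuit F d A B W) (ψ : QReg F d A B W → ℂ) :
    O.run (c ++ c') ψ = O.run c' (O.run c ψ) :=
  List.foldl_append

theorem HiddenRadiusOracle.sum_norm_run_sq (O : HiddenRadiusOracle F d A B r)
    (c : QueryCircuit F d A B W) (ψ : QReg F d A B W → ℂ) :
    ∑ z, ‖O.run c ψ z‖ ^ 2 = ∑ z, ‖ψ z‖ ^ 2 := by
  induction c generalizing ψ with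
  | nil => rfl
  | cons step c ih =>
    exact (ih _).trans ((sum_norm_mulVec_sq step.2.2 _).trans (O.sum_norm_query_sq step.1 ψ))

variable [Fintype R] [DecidableEq R]

/-- The circuit that ignores the part `R` of its work space. -/
def QueryCircuit.extend (R : Type) [Fintype R] [DecidableEq R] (c : QueryCircuit F d A B W) :
    QueryCircuit F d A B (W × R) :=
  c.map fun step => (step.1, reindexUnitary (regroupWork F d A B W R) (kroneckerOne R step.2))

theorem kroneckerOne_mulVec_mul {ι : Type*} [Fintype ι] [DecidableEq ι]
    (U : Matrix.unitaryGroup ι ℂ) (φ : ι → ℂ) (χ : R → ℂ) :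
    (kroneckerOne R U).1 *ᵥ (fun z => φ z.1 * χ z.2) = fun z => (U.1 *ᵥ φ) z.1 * χ z.2 := by
  ext z
  rw [kroneckerOne, kronecker_one_mulVec_apply]
  simp only [Matrix.mulVec, dotProduct, Finset.sum_mul, mul_assoc]

theorem HiddenRadiusOracle.run_extend_tensorState (O : HiddenRadiusOracle F d A B r)
    (c : QueryCircuit F d A B W) (φ : QReg F d A B W → ℂ) (χ : R → ℂ) :
    O.run (QueryCircuit.extend R c) (tensorState φ χ) = tensorState (O.run c φ) χ := by
  induction c generalizing φ with
  | nil => rfl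
  | cons step c ih =>
    have hstep : (reindexUnitary (regroupWork F d A B W R) (kroneckerOne R step.2)).1 *ᵥ
        O.query step.1 (tensorState φ χ) = tensorState (step.2.1 *ᵥ O.query step.1 φ) χ := by
      rw [O.query_tensorState, tensorState, reindexUnitary_mulVec_comp, kroneckerOne_mulVec_mul,
        tensorState]
    exact (congrArg (O.run (QueryCircuit.extend R c)) hstep).trans (ih _)

end QueryCircuit

section ParallelRepetition

set_option synthInstance.maxSize 1000

open scoped Matrix

variable {F : Type} {d : ℕ} {A B : Type} {r : F} {W : Type} {n : ℕ}

/-- The exchange of a system with the `i`-th of `n` copies of it. -/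
def slotSwap {α : Type*} (i : Fin n) : Equiv.Perm (α × (Fin n → α)) :=
  Function.Involutive.toPerm (fun z => (z.2 i, Function.update z.2 i z.1)) fun z => by simp

theorem mul_prod_slotSwap {α : Type*} (φ : α → ℂ) (χ : Fin n → α → ℂ) (i : Fin n)
    (z : α × (Fin n → α)) :
    φ (slotSwap i z).1 * ∏ j, χ j ((slotSwap i z).2 j) =
      χ i z.1 * ∏ j, Function.update χ i φ j (z.2 j) := by
  change φ (z.2 i) * ∏ j, χ j (Function.update z.2 i z.1 j) = _
  have hother (j) (hj : j ∈ Finset.univ.erase i) :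
      χ j (Function.update z.2 i z.1 j) = Function.update χ i φ j (z.2 j) := by
    rw [Function.update_of_ne (Finset.ne_of_mem_erase hj),
      Function.update_of_ne (Finset.ne_of_mem_erase hj)]
  rw [← Finset.mul_prod_erase _ _ (Finset.mem_univ i), Finset.prod_congr rfl hother,
    ← Finset.mul_prod_erase _ (fun j => Function.update χ i φ j (z.2 j)) (Finset.mem_univ i),
    Function.update_self, Function.update_self, mul_left_comm]

/-- The product of a state of the query registers with work space `W` and of states of `n` copies
of this system. -/
def prodState (φ : QReg F d A B W → ℂ) (χ : Fin n → QReg F d A B W → ℂ) :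
    QReg F d A B (W × (Fin n → QReg F d A B W)) → ℂ :=
  tensorState φ fun y => ∏ j, χ j (y j)

variable [Fintype F] [Fintype A] [Fintype B] [Fintype W]

theorem sum_norm_prodState_sq (φ : QReg F d A B W → ℂ) (χ : Fin n → QReg F d A B W → ℂ) :
    ∑ z, ‖prodState φ χ z‖ ^ 2 = (∑ z, ‖φ z‖ ^ 2) * ∏ j, ∑ z, ‖χ j z‖ ^ 2 := by
  refine ((regroupWork F d A B W (Fin n → _)).sum_comp
    fun z => ‖φ z.1 * ∏ j, χ j (z.2 j)‖ ^ 2).trans ?_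
  rw [Fintype.sum_prod_type, Finset.prod_univ_sum, Fintype.piFinset_univ, Finset.sum_mul_sum]
  simp only [norm_mul, norm_prod, mul_pow, Finset.prod_pow]

theorem measurementProb_prodState {κ : Type*} [DecidableEq κ] (f : QReg F d A B W → κ)
    {φ : QReg F d A B W → ℂ} (hφ : ∑ z, ‖φ z‖ ^ 2 = 1) (χ : Fin n → QReg F d A B W → ℂ)
    (o : Fin n → κ) :
    measurementProb (fun z j => f (z.2.2.2.2 j)) (prodState φ χ) o =
      ∏ j, measurementProb f (χ j) (o j) := by
  have hmul := measurementProb_mul φ (fun (y : Fin n → QReg F d A B W) j => f (y j))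
    (fun y => ∏ j, χ j (y j)) o
  rw [hφ, one_mul, measurementProb_prod] at hmul
  exact (measurementProb_comp_equiv (regroupWork F d A B W _) _ _ o).trans hmul

variable [DecidableEq F] [DecidableEq A] [DecidableEq B] [DecidableEq W] [Field F]
variable [AddCommGroup A] [AddCommGroup B]

/-- The circuit `c ++ [(κ, V)]`, followed by the exchange of the query registers and the `i`-th
copy of them. -/
def repetitionRound (n : ℕ) (c : QueryCircuit F d A B W) (κ : QueryKind)
    (V : Matrix.unitaryGroup (QReg F d A B W) ℂ) (i : Fin n) :
    QueryCircuit F d A B (W × (Fin n → QReg F d A B W)) :=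
  QueryCircuit.extend _ c ++ [(κ, reindexUnitary (regroupWork F d A B W _)
    (permUnitary (slotSwap i) * kroneckerOne _ V))]

theorem HiddenRadiusOracle.run_repetitionRound (O : HiddenRadiusOracle F d A B r)
    (c : QueryCircuit F d A B W) (κ : QueryKind) (V : Matrix.unitaryGroup (QReg F d A B W) ℂ)
    (i : Fin n) (φ : QReg F d A B W → ℂ) (χ : Fin n → QReg F d A B W → ℂ) :
    O.run (repetitionRound n c κ V i) (prodState φ χ) =
      prodState (χ i) (Function.update χ i (O.run (c ++ [(κ, V)]) φ)) := by
  rw [repetitionRound, O.run_append, prodState, O.run_extend_tensorState, O.run_append]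
  change (reindexUnitary _ _).1 *ᵥ O.query κ (tensorState _ _) = _
  rw [O.query_tensorState, tensorState, reindexUnitary_mulVec_comp, Submonoid.coe_mul,
    ← Matrix.mulVec_mulVec, kroneckerOne_mulVec_mul V _ fun y : Fin n → _ => ∏ j, χ j (y j),
    permUnitary_mulVec]
  exact congrArg (· ∘ regroupWork F d A B W _) (funext fun z => mul_prod_slotSwap _ χ i z)

theorem HiddenRadiusOracle.run_flatMap_repetitionRound (O : HiddenRadiusOracle F d A B r)
    (c : QueryCircuit F d A B W) (κ : QueryKind) (V : Matrix.unitaryGroup (QReg F d A B W) ℂ)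
    (ψ : QReg F d A B W → ℂ) (l : List (Fin n)) (hl : l.Nodup)
    (χ : Fin n → QReg F d A B W → ℂ) (hχ : ∀ i ∈ l, χ i = ψ) :
    O.run (l.flatMap (repetitionRound n c κ V)) (prodState ψ χ) =
      prodState ψ fun j => if j ∈ l then O.run (c ++ [(κ, V)]) ψ else χ j := by
  induction l generalizing χ with
  | nil => simp [HiddenRadiusOracle.run]
  | cons i l ih =>
    have hi : i ∉ l := (List.nodup_cons.mp hl).1
    rw [List.flatMap_cons, O.run_append, O.run_repetitionRound, hχ i List.mem_cons_self,
      ih hl.of_cons]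
    · congr 1
      ext j : 1
      by_cases hj : j = i
      · subst hj; simp [hi]
      · simp [hj]
    · intro j hj
      rw [Function.update_of_ne (ne_of_mem_of_not_mem hj hi), hχ j (List.mem_cons_of_mem i hj)]

theorem exists_parallelRepetition {κ : Type} [Fintype κ] [DecidableEq κ] (n : ℕ) (w₀ : W)
    {ψ : QReg F d A B W → ℂ} (hψ : ∑ z, ‖ψ z‖ ^ 2 = 1) {c : QueryCircuit F d A B W}
    (hc : c ≠ []) (f : QReg F d A B W → κ)
    (est : (Fin n → κ) → F) :
    ∃ alg : QueryAlgorithm F d A B, alg.numQueries = n * c.length ∧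
      ∀ (r : F) (O : HiddenRadiusOracle F d A B r) (v : F), alg.prob O v =
        ∑ o : Fin n → κ, if est o = v then
          ∏ j, measurementProb f (O.run c ψ) (o j) else 0 := by
  obtain ⟨c, ⟨k, V⟩, rfl⟩ := (List.eq_nil_or_concat' c).resolve_left hc
  have hprod : ∑ z, ‖prodState ψ (fun _ : Fin n => ψ) z‖ ^ 2 = 1 := by
    simp only [sum_norm_prodState_sq, hψ, Finset.prod_const_one, mul_one]
  obtain ⟨U, hU⟩ := exists_unitary_mulVec_single (0, 0, 0, w₀, fun _ => (0, 0, 0, w₀)) hprod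
  let alg : QueryAlgorithm F d A B :=
    { W := W × (Fin n → QReg F d A B W)
      w₀ := (w₀, fun _ => (0, 0, 0, w₀))
      first := U
      steps := (List.finRange n).flatMap (repetitionRound n c k V)
      output := est ∘ fun z j => f (z.2.2.2.2 j) }
  refine ⟨alg, ?_, fun r O v => ?_⟩
  · simp [alg, QueryAlgorithm.numQueries, List.length_flatMap, repetitionRound,
      QueryCircuit.extend]
  · have hfinal : alg.finalState O = prodState ψ fun _ => O.run (c ++ [(k, V)]) ψ := by
      have h := O.run_flatMap_repetitionRound c k V ψ (List.finRange n) (List.nodup_finRange n)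
        (fun _ => ψ) fun _ _ => rfl
      simp only [List.mem_finRange, if_true] at h
      rw [← hU] at h
      exact h
    change measurementProb alg.output (alg.finalState O) v = _
    rw [hfinal, measurementProb_comp]
    simp only [measurementProb_prodState f hψ]

end ParallelRepetition

/-! ## The distribution of one sample -/

section OutcomeDistribution

variable {F : Type} [Field F] [Fintype F] {d : ℕ}

/-- The distribution of one sample when there are `a` offset labels: either no centre label is
found, or the point register holds a Fourier sample. -/
noncomputable def outcomeProb (d a : ℕ) (r : F) : Option (Fin d → F) → ℝ
  | none => 1 - (radiusSphere d r).card / a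
  | some k => (radiusSphere d r).card / a * fourierProb r k

theorem outcomeProb_nonneg {a : ℕ} {r : F} (h : (radiusSphere d r).card ≤ a) :
    ∀ o, 0 ≤ outcomeProb d a r o
  | none => sub_nonneg.mpr (div_le_one_of_le₀ (Nat.cast_le.mpr h) (Nat.cast_nonneg _))
  | some k => mul_nonneg (by positivity) (fourierProb_nonneg r k)

theorem sum_outcomeProb (a : ℕ) {r : F} (h : (radiusSphere d r).Nonempty) :
    ∑ o, outcomeProb d a r o = 1 := by
  simp only [Fintype.sum_option, outcomeProb]
  rw [← Finset.mul_sum, sum_fourierProb h, mul_one, sub_add_cancel]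

theorem mul_fourierTV_le_sum_outcomeProb {r r' : F} (a : ℕ) (h' : (radiusSphere d r').Nonempty) :
    (radiusSphere d r).card / a * fourierTV d r r' ≤
      1 / 2 * ∑ o, |outcomeProb d a r o - outcomeProb d a r' o| := by
  simp only [Fintype.sum_option, outcomeProb, fourierTV]
  set s : ℝ := (radiusSphere d r).card / a
  set s' : ℝ := (radiusSphere d r').card / a
  have hs : 0 ≤ s := by positivity
  have hterm (k : Fin d → F) : s * |fourierProb r k - fourierProb r' k| ≤
      |s * fourierProb r k - s' * fourierProb r' k| + |s - s'| * fourierProb r' k := by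
    calc s * |fourierProb r k - fourierProb r' k|
        = |s * fourierProb r k - s * fourierProb r' k| := by
          rw [← mul_sub, abs_mul, abs_of_nonneg hs]
      _ ≤ |s * fourierProb r k - s' * fourierProb r' k| +
          |s' * fourierProb r' k - s * fourierProb r' k| := abs_sub_le _ _ _
      _ = _ := by rw [← sub_mul, abs_mul, abs_of_nonneg (fourierProb_nonneg r' k), abs_sub_comm s']
  have hsum := Finset.sum_le_sum fun k (_ : k ∈ Finset.univ) => hterm k
  rw [← Finset.mul_sum, Finset.sum_add_distrib, ← Finset.mul_sum, sum_fourierProb h',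
    mul_one] at hsum
  rw [sub_sub_sub_cancel_left, abs_sub_comm s' s]
  linarith

variable {A B : Type} [AddCommGroup A] [AddCommGroup B] {r : F}

theorem HiddenRadiusOracle.card_radiusSphere_le [Fintype A] (O : HiddenRadiusOracle F d A B r) :
    (radiusSphere d r).card ≤ Fintype.card A := by
  have h := Fintype.card_le_of_injective (fun s => (O.encOffset s : A))
    (Subtype.val_injective.comp O.encOffset.injective)
  rwa [Fintype.card_coe] at h

theorem HiddenRadiusOracle.fwd_eq_zero_or (O : HiddenRadiusOracle F d A B r) (x : Fin d → F)
    (a : A) : O.fwd x a = 0 ∨ ∃ s, (O.encOffset s : A) = a :=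
  or_iff_not_imp_right.mpr fun h => dif_neg h

theorem HiddenRadiusOracle.eq_fwd_bwd_sub_iff (O : HiddenRadiusOracle F d A B r) (x : Fin d → F)
    (a : A) {b : B} (hb : b ≠ 0) :
    b = O.fwd x (O.bwd x b - a) ↔
      a = 0 ∧ ∃ t, (O.encCenter t : B) = b ∧ x - t ∈ radiusSphere d r := by
  constructor
  · intro h
    rcases O.fwd_eq_zero_or x (O.bwd x b - a) with h0 | ⟨s, hs⟩
    · exact absurd (h.trans h0) hb
    · rw [← hs, O.fwd_encOffset] at h
      rw [h, O.bwd_encCenter, eq_comm, sub_eq_self] at hs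
      exact ⟨hs, x - s.1, h.symm, (sub_sub_cancel x s.1).symm ▸ s.2⟩
  · rintro ⟨rfl, t, rfl, ht⟩
    have hbwd := O.bwd_encCenter x ⟨x - t, ht⟩
    have hfwd := O.fwd_encOffset x ⟨x - t, ht⟩
    rw [sub_sub_cancel] at hbwd hfwd
    rw [sub_zero, hbwd, hfwd]

section SamplingCircuit

open scoped Matrix

variable [Fintype A] [Fintype B] [DecidableEq B]

/-- The uniform superposition over all points and all offset labels, with a blank centre label. -/
noncomputable def uniformState (F : Type) [Fintype F] (d : ℕ) (A B : Type) [Fintype A]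
    [AddCommGroup B] [DecidableEq B] : QReg F d A B Unit → ℂ :=
  fun z => if z.2.2.1 = 0 then
    ((1 / Real.sqrt ((Fintype.card F : ℝ) ^ d * Fintype.card A) : ℝ) : ℂ) else 0

theorem sum_norm_uniformState_sq : ∑ z, ‖uniformState F d A B z‖ ^ 2 = 1 := by
  have hA : (Fintype.card A : ℝ) ≠ 0 := Nat.cast_ne_zero.mpr Fintype.card_ne_zero
  have hF : (Fintype.card F : ℝ) ≠ 0 := Nat.cast_ne_zero.mpr Fintype.card_ne_zero
  simp only [Fintype.sum_prod_type, uniformState, apply_ite norm, norm_zero, Complex.norm_real,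
    Real.norm_eq_abs, ite_pow, sq_abs, div_pow, one_pow]
  rw [Real.sq_sqrt (by positivity)]
  simp [hA, hF]

variable [DecidableEq F] [DecidableEq A]

/-- The circuit that finds the encryption of a centre and takes a Fourier sample: after the query
to `f₁`, the query to `f₋₁` erases the negated offset label. -/
noncomputable def samplingCircuit (F : Type) [Field F] [Fintype F] [DecidableEq F] (d : ℕ)
    (A B : Type) [AddCommGroup A] [Fintype A] [DecidableEq A] [Fintype B] [DecidableEq B] :
    QueryCircuit F d A B Unit :=
  [(.fwd, permUnitary ((Equiv.refl _).prodCongr ((Equiv.neg A).prodCongr (Equiv.refl _)))),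
    (.bwd, kroneckerOne _ ⟨fourierMatrix F d, fourierMatrix_mem_unitaryGroup⟩)]

theorem HiddenRadiusOracle.run_samplingCircuit (O : HiddenRadiusOracle F d A B r)
    (ψ : QReg F d A B Unit → ℂ) (k : Fin d → F) (a : A) (b : B) (w : Unit) :
    O.run (samplingCircuit F d A B) ψ (k, a, b, w) =
      (fourierMatrix F d *ᵥ fun x =>
        ψ (x, O.bwd x b - a, b - O.fwd x (O.bwd x b - a), w)) k := by
  change (Matrix.kronecker (fourierMatrix F d) 1 *ᵥ
    O.query .bwd ((permUnitary _).1 *ᵥ O.query .fwd ψ)) _ = _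
  rw [kronecker_one_mulVec_apply, permUnitary_mulVec]
  simp only [← neg_sub a]
  rfl

/-- The state of the registers that hold one sample. -/
noncomputable def sampleState (O : HiddenRadiusOracle F d A B r) : QReg F d A B Unit → ℂ :=
  O.run (samplingCircuit F d A B) (uniformState F d A B)

theorem sum_norm_sampleState_sq (O : HiddenRadiusOracle F d A B r) :
    ∑ z, ‖sampleState O z‖ ^ 2 = 1 :=
  (O.sum_norm_run_sq _ _).trans sum_norm_uniformState_sq

theorem sampleState_eq_zero (O : HiddenRadiusOracle F d A B r) (k : Fin d → F) {a : A} {b : B}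
    (w : Unit) (hb : b ≠ 0) (h : ¬ (a = 0 ∧ ∃ t, (O.encCenter t : B) = b)) :
    sampleState O (k, a, b, w) = 0 := by
  have hzero (x : Fin d → F) : uniformState F d A B
      (x, O.bwd x b - a, b - O.fwd x (O.bwd x b - a), w) = 0 := by
    rw [uniformState, if_neg]
    rw [sub_eq_zero, O.eq_fwd_bwd_sub_iff x a hb]
    exact fun ⟨ha, t, ht, _⟩ => h ⟨ha, t, ht⟩
  rw [sampleState, O.run_samplingCircuit]
  simp only [hzero]
  exact congrFun (Matrix.mulVec_zero _) k

theorem sampleState_encCenter (O : HiddenRadiusOracle F d A B r) (k t : Fin d → F) (w : Unit) :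
    sampleState O (k, 0, O.encCenter t, w) =
      (Real.sqrt (radiusSphere d r).card /
        Real.sqrt ((Fintype.card F : ℝ) ^ d * Fintype.card A) : ℝ) *
      (fourierMatrix F d *ᵥ sphereState r t) k := by
  rw [sampleState, O.run_samplingCircuit, ← smul_eq_mul, ← Pi.smul_apply, ← Matrix.mulVec_smul]
  congr 2
  ext x
  have hiff : (∃ t', (O.encCenter t' : B) = O.encCenter t ∧ x - t' ∈ radiusSphere d r) ↔
      x - t ∈ radiusSphere d r := by
    simp [Subtype.ext_iff.symm, O.encCenter.injective.eq_iff]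
  simp only [uniformState, sub_eq_zero, O.eq_fwd_bwd_sub_iff x 0 (O.encCenter t).2, true_and,
    hiff, Pi.smul_apply, sphereState, smul_eq_mul, mul_ite, mul_zero]
  split_ifs with hx
  · have hN : Real.sqrt (radiusSphere d r).card ≠ 0 :=
      (Real.sqrt_pos.mpr (Nat.cast_pos.mpr (Finset.card_pos.mpr ⟨_, hx⟩))).ne'
    rw [← Complex.ofReal_mul, div_mul_div_comm, mul_one, mul_comm (Real.sqrt (_ * _)),
      div_mul_cancel_left₀ hN, one_div]
  · rfl

/-- The part of a sample that is used: its Fourier sample, unless the centre label is blank. -/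
def sampleOutcome (z : QReg F d A B Unit) : Option (Fin d → F) :=
  if z.2.2.1 = 0 then none else some z.1

theorem measurementProb_sampleState_some (O : HiddenRadiusOracle F d A B r) (k : Fin d → F) :
    measurementProb sampleOutcome (sampleState O) (some k) =
      outcomeProb d (Fintype.card A) r (some k) := by
  have hlabel (t : Fin d → F) : ‖sampleState O (k, 0, O.encCenter t, ())‖ ^ 2 =
      (radiusSphere d r).card / Fintype.card A * fourierProb r k / (Fintype.card F : ℝ) ^ d := by
    rw [sampleState_encCenter, norm_mul, mul_pow, ← fourierProb_eq_norm_mulVec_sq,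
      Complex.norm_real, Real.norm_eq_abs, sq_abs, div_pow, Real.sq_sqrt (by positivity),
      Real.sq_sqrt (by positivity)]
    ring
  have hsum : ∑ t, ‖sampleState O (k, 0, O.encCenter t, ())‖ ^ 2 =
      measurementProb sampleOutcome (sampleState O) (some k) := by
    refine Fintype.sum_of_injective (fun t => ((k, 0, O.encCenter t, ()) : QReg F d A B Unit))
      ?_ _ _ ?_ fun t => ?_
    · exact fun t t' h => O.encCenter.injective (Subtype.ext (congrArg (·.2.2.1) h))
    · rintro ⟨k', a, b, w⟩ hz
      refine ite_eq_right_iff.mpr fun hk => ?_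
      obtain ⟨hb, rfl⟩ : b ≠ 0 ∧ k' = k := by simpa [sampleOutcome] using hk
      rw [sampleState_eq_zero O k' w hb, norm_zero, zero_pow two_ne_zero]
      rintro ⟨rfl, t, rfl⟩
      exact hz ⟨t, rfl⟩
    · simp [sampleOutcome, (O.encCenter t).2]
  have hq : (Fintype.card F : ℝ) ≠ 0 := Nat.cast_ne_zero.mpr Fintype.card_ne_zero
  rw [← hsum, Fintype.sum_congr _ _ hlabel]
  simp [outcomeProb, field]

theorem measurementProb_sampleState (O : HiddenRadiusOracle F d A B r)
    (h : (radiusSphere d r).Nonempty) (o : Option (Fin d → F)) :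
    measurementProb sampleOutcome (sampleState O) o = outcomeProb d (Fintype.card A) r o := by
  cases o with
  | some k => exact measurementProb_sampleState_some O k
  | none =>
    have htotal : ∑ o, measurementProb sampleOutcome (sampleState O) o =
        ∑ o, outcomeProb d (Fintype.card A) r o := by
      rw [sum_measurementProb, sum_norm_sampleState_sq, sum_outcomeProb _ h]
    simp only [Fintype.sum_option, measurementProb_sampleState_some] at htotal
    exact add_right_cancel htotal

theorem exists_samplingAlgorithm (F : Type) [Field F] [Fintype F] [DecidableEq F] (d : ℕ)
    (A B : Type) [AddCommGroup A] [Fintype A] [DecidableEq A]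
    [AddCommGroup B] [Fintype B] [DecidableEq B] (n : ℕ)
    (est : (Fin n → Option (Fin d → F)) → F) :
    ∃ alg : QueryAlgorithm F d A B, alg.numQueries = 2 * n ∧
      ∀ (r : F), (radiusSphere d r).Nonempty → ∀ (O : HiddenRadiusOracle F d A B r) (v : F),
        alg.prob O v = ∑ o : Fin n → Option (Fin d → F),
          if est o = v then ∏ j, outcomeProb d (Fintype.card A) r (o j) else 0 := by
  obtain ⟨alg, hnum, hprob⟩ := exists_parallelRepetition n () sum_norm_uniformState_sq
    (c := samplingCircuit F d A B) (List.cons_ne_nil _ _) sampleOutcome est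
  refine ⟨alg, hnum.trans (mul_comm _ _), fun r h O v => ?_⟩
  simp only [← measurementProb_sampleState O h]
  exact hprob r O v

end SamplingCircuit

end OutcomeDistribution

/-! ## Maximum likelihood estimation -/

section MaximumLikelihood

variable {O : Type*} [Fintype O] {P Q : O → ℝ}

/-- The Bhattacharyya coefficient of two finite distributions. -/
noncomputable def bhattacharyya (P Q : O → ℝ) : ℝ := ∑ o, √(P o * Q o)

theorem bhattacharyya_nonneg (P Q : O → ℝ) : 0 ≤ bhattacharyya P Q :=
  Finset.sum_nonneg fun _ _ => Real.sqrt_nonneg _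

theorem sum_sqrt_add_mul_sqrt_sq (hP : ∀ o, 0 ≤ P o) (hQ : ∀ o, 0 ≤ Q o) (hP1 : ∑ o, P o = 1)
    (hQ1 : ∑ o, Q o = 1) {c : ℝ} (hc : c ^ 2 = 1) :
    ∑ o, (√(P o) + c * √(Q o)) ^ 2 = 2 + 2 * c * bhattacharyya P Q := by
  have hterm (o : O) : (√(P o) + c * √(Q o)) ^ 2 = P o + Q o + 2 * c * √(P o * Q o) := by
    rw [Real.sqrt_mul (hP o)]
    linear_combination Real.sq_sqrt (hP o) + c ^ 2 * Real.sq_sqrt (hQ o) + Q o * hc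
  simp_rw [hterm, bhattacharyya]
  rw [Finset.sum_add_distrib, Finset.sum_add_distrib, hP1, hQ1, Finset.mul_sum]
  norm_num

theorem sq_totalVariation_add_sq_bhattacharyya_le_one (hP : ∀ o, 0 ≤ P o) (hQ : ∀ o, 0 ≤ Q o)
    (hP1 : ∑ o, P o = 1) (hQ1 : ∑ o, Q o = 1) :
    (1 / 2 * ∑ o, |P o - Q o|) ^ 2 + bhattacharyya P Q ^ 2 ≤ 1 := by
  have hfactor (o : O) :
      |P o - Q o| = |√(P o) + -1 * √(Q o)| * |√(P o) + 1 * √(Q o)| := by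
    rw [← abs_mul]
    congr 1
    linear_combination -Real.sq_sqrt (hP o) + Real.sq_sqrt (hQ o)
  have hcauchy := Finset.sum_mul_sq_le_sq_mul_sq Finset.univ
    (fun o => |√(P o) + -1 * √(Q o)|) fun o => |√(P o) + 1 * √(Q o)|
  simp only [← hfactor, sq_abs] at hcauchy
  rw [sum_sqrt_add_mul_sqrt_sq hP hQ hP1 hQ1 (by norm_num),
    sum_sqrt_add_mul_sqrt_sq hP hQ hP1 hQ1 (by norm_num)] at hcauchy
  linarith

theorem bhattacharyya_le_of_le_totalVariation (hP : ∀ o, 0 ≤ P o) (hQ : ∀ o, 0 ≤ Q o)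
    (hP1 : ∑ o, P o = 1) (hQ1 : ∑ o, Q o = 1) {τ : ℝ} (hτ : 0 ≤ τ)
    (h : τ ≤ 1 / 2 * ∑ o, |P o - Q o|) : bhattacharyya P Q ≤ 1 - τ ^ 2 / 2 := by
  have hbound := sq_totalVariation_add_sq_bhattacharyya_le_one hP hQ hP1 hQ1
  have hsq : τ ^ 2 ≤ (1 / 2 * ∑ o, |P o - Q o|) ^ 2 := pow_le_pow_left₀ hτ h 2
  have hτ1 : τ ^ 2 ≤ 1 := by linarith [sq_nonneg (bhattacharyya P Q)]
  refine le_of_sq_le_sq ?_ (by linarith)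
  linarith [sq_nonneg (τ ^ 2)]

theorem sum_prod_of_prod_le_le_bhattacharyya_pow (hP : ∀ o, 0 ≤ P o) (hQ : ∀ o, 0 ≤ Q o) (n : ℕ) :
    ∑ w : Fin n → O, (if ∏ j, P (w j) ≤ ∏ j, Q (w j) then ∏ j, P (w j) else 0) ≤
      bhattacharyya P Q ^ n := by
  rw [bhattacharyya, Fintype.sum_pow]
  refine Finset.sum_le_sum fun w _ => ?_
  have hprod : 0 ≤ ∏ j, P (w j) := Finset.prod_nonneg fun j _ => hP _
  split_ifs with hle
  · calc ∏ j, P (w j) = √((∏ j, P (w j)) * ∏ j, P (w j)) := (Real.sqrt_mul_self hprod).symm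
      _ ≤ √((∏ j, P (w j)) * ∏ j, Q (w j)) := by gcongr
      _ = ∏ j, √(P (w j) * Q (w j)) := by
        rw [← Finset.prod_mul_distrib, Real.sqrt_prod _ fun j _ => mul_nonneg (hP _) (hQ _)]
  · exact Finset.prod_nonneg fun j _ => Real.sqrt_nonneg _

variable {α : Type*} [Nonempty α]

/-- The element of `S` at which `L` is strictly larger than at all other elements of `S`; an
arbitrary value if there is none. -/
noncomputable def strictArgmax (S : Finset α) (L : α → ℝ) : α :=
  Classical.epsilon fun v => v ∈ S ∧ ∀ v' ∈ S, v' ≠ v → L v' < L v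

theorem strictArgmax_eq {S : Finset α} {L : α → ℝ} {v : α} (hv : v ∈ S)
    (h : ∀ v' ∈ S, v' ≠ v → L v' < L v) : strictArgmax S L = v := by
  obtain ⟨hmem, hmax⟩ : strictArgmax S L ∈ S ∧
      ∀ v' ∈ S, v' ≠ strictArgmax S L → L v' < L (strictArgmax S L) :=
    Classical.epsilon_spec (p := fun v => v ∈ S ∧ ∀ v' ∈ S, v' ≠ v → L v' < L v) ⟨v, hv, h⟩
  by_contra hne
  exact lt_asymm (h _ hmem hne) (hmax v hv (Ne.symm hne))

theorem one_sub_le_sum_strictArgmax [DecidableEq α] (n : ℕ) {S : Finset α} {P : α → O → ℝ} {r : α}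
    (hP : ∀ v ∈ S, ∀ o, 0 ≤ P v o) (hr : r ∈ S) (hP1 : ∑ o, P r o = 1) :
    1 - ∑ v ∈ S.erase r, bhattacharyya (P r) (P v) ^ n ≤ ∑ w : Fin n → O,
      if strictArgmax S (fun v => ∏ j, P v (w j)) = r then ∏ j, P r (w j) else 0 := by
  let err (v : α) (w : Fin n → O) : ℝ :=
    if ∏ j, P r (w j) ≤ ∏ j, P v (w j) then ∏ j, P r (w j) else 0
  have hprod (w : Fin n → O) : 0 ≤ ∏ j, P r (w j) := Finset.prod_nonneg fun j _ => hP r hr _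
  have herr (w : Fin n → O) (v : α) : 0 ≤ err v w := ite_nonneg (hprod w) le_rfl
  have hunion (w : Fin n → O) : ∏ j, P r (w j) ≤
      (if strictArgmax S (fun v => ∏ j, P v (w j)) = r then ∏ j, P r (w j) else 0) +
        ∑ v ∈ S.erase r, err v w := by
    split_ifs with hest
    · exact le_add_of_nonneg_right (Finset.sum_nonneg fun v _ => herr w v)
    · obtain ⟨v, hv, hvr, hle⟩ : ∃ v ∈ S, v ≠ r ∧ ∏ j, P r (w j) ≤ ∏ j, P v (w j) := by
        by_contra! hlt
        exact hest (strictArgmax_eq hr hlt)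
      calc ∏ j, P r (w j) = err v w := (if_pos hle).symm
        _ ≤ ∑ v ∈ S.erase r, err v w :=
          Finset.single_le_sum (fun v _ => herr w v) (Finset.mem_erase.mpr ⟨hvr, hv⟩)
        _ = _ := (zero_add _).symm
  have hsum := Finset.sum_le_sum fun w (_ : w ∈ Finset.univ) => hunion w
  rw [← Fintype.sum_pow, hP1, one_pow, Finset.sum_add_distrib, Finset.sum_comm] at hsum
  have hpair := Finset.sum_le_sum fun v (hv : v ∈ S.erase r) =>
    sum_prod_of_prod_le_le_bhattacharyya_pow (hP r hr) (hP v (Finset.mem_of_mem_erase hv)) n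
  linarith

end MaximumLikelihood

/-! ## The hidden radius problem -/

section HiddenRadiusProblem

variable {F : Type} [Field F] [Fintype F] {d : ℕ}

theorem one_le_of_pos_of_le_mul {a K b : ℕ} (ha : 0 < a) (h : a ≤ K * b) : 1 ≤ K :=
  Nat.pos_of_ne_zero (by rintro rfl; omega)

/-- The guaranteed distance from `1` of the Bhattacharyya coefficient of the sample distributions of
two radii, when there are at most `K * q ^ (d - 1)` offset labels. With `2 / 3 * q ^ (d - 1)` points
on a sphere and total variation distance `1 / 12` between Fourier samples, the samples have total
variation distance at least `2 / (3 * K) * (1 / 12) = 1 / (18 * K)`. -/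
noncomputable def bhattacharyyaGap (K : ℕ) : ℝ := (1 / (18 * K)) ^ 2 / 2

theorem bhattacharyyaGap_mem_Ioc {K : ℕ} (hK : 1 ≤ K) : bhattacharyyaGap K ∈ Set.Ioc 0 1 := by
  have hK' : (1 : ℝ) ≤ K := Nat.one_le_cast.mpr hK
  have hle : 1 / (18 * K : ℝ) ≤ 1 := (div_le_one (by positivity)).mpr (by linarith)
  rw [bhattacharyyaGap]
  refine ⟨by positivity, ?_⟩
  linarith [pow_le_one₀ (n := 2) (by positivity) hle]

theorem le_sum_outcomeProb {K a : ℕ} {r r' : F} (hq : Odd (Fintype.card F)) (hd : Odd d)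
    (ha : 0 < a) (haK : a ≤ K * Fintype.card F ^ (d - 1)) (h : (radiusSphere d r).Nonempty)
    (h' : (radiusSphere d r').Nonempty) (hne : r ≠ r') :
    1 / (18 * K) ≤ 1 / 2 * ∑ o, |outcomeProb d a r o - outcomeProb d a r' o| := by
  refine le_trans ?_ (mul_fourierTV_le_sum_outcomeProb a h')
  have ha' : (0 : ℝ) < a := Nat.cast_pos.mpr ha
  have hK : (0 : ℝ) < K := Nat.cast_pos.mpr (Nat.pos_of_mul_pos_right (ha.trans_le haK))
  have hratio : 2 / (3 * (K : ℝ)) ≤ (radiusSphere d r).card / a := by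
    rw [div_le_div_iff₀ (by positivity) ha']
    calc 2 * (a : ℝ) ≤ 2 * (K * (Fintype.card F : ℝ) ^ (d - 1)) := by
          gcongr
          exact_mod_cast haK
      _ = 2 / 3 * (Fintype.card F : ℝ) ^ (d - 1) * (3 * K) := by ring
      _ ≤ (radiusSphere d r).card * (3 * K) := by
        gcongr
        exact card_radiusSphere_ge_of_nonempty hq hd h
  calc 1 / (18 * (K : ℝ)) = 2 / (3 * K) * (1 / 12) := by field_simp; norm_num
    _ ≤ (radiusSphere d r).card / a * fourierTV d r r' := by
      gcongr
      exact fourierTV_ge hq hd h h' hne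

theorem bhattacharyya_outcomeProb_le {K a : ℕ} {r r' : F} (hq : Odd (Fintype.card F)) (hd : Odd d)
    (ha : 0 < a) (haK : a ≤ K * Fintype.card F ^ (d - 1))
    (h : (radiusSphere d r).Nonempty) (hle : (radiusSphere d r).card ≤ a)
    (h' : (radiusSphere d r').Nonempty) (hle' : (radiusSphere d r').card ≤ a) (hne : r ≠ r') :
    bhattacharyya (outcomeProb d a r) (outcomeProb d a r') ≤ 1 - bhattacharyyaGap K :=
  bhattacharyya_le_of_le_totalVariation (outcomeProb_nonneg hle) (outcomeProb_nonneg hle')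
    (sum_outcomeProb a h) (sum_outcomeProb a h') (by positivity)
    (le_sum_outcomeProb hq hd ha haK h h' hne)

open Classical in
/-- The radii that a hidden radius oracle with `a` offset labels can have. -/
noncomputable def candidateRadii (F : Type) [Field F] [Fintype F] (d a : ℕ) : Finset F :=
  {r | (radiusSphere d r).Nonempty ∧ (radiusSphere d r).card ≤ a}

theorem mem_candidateRadii {a : ℕ} {r : F} : r ∈ candidateRadii F d a ↔
    (radiusSphere d r).Nonempty ∧ (radiusSphere d r).card ≤ a := by
  simp [candidateRadii]

theorem exists_maximumLikelihoodAlgorithm [DecidableEq F] (A B : Type)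
    [AddCommGroup A] [Fintype A] [DecidableEq A] [AddCommGroup B] [Fintype B] [DecidableEq B]
    {K : ℕ} (hq : Odd (Fintype.card F)) (hd : Odd d)
    (hA : Fintype.card A ≤ K * Fintype.card F ^ (d - 1)) (n : ℕ) :
    ∃ alg : QueryAlgorithm F d A B, alg.numQueries = 2 * n ∧
      ∀ r : F, (radiusSphere d r).Nonempty → ∀ O : HiddenRadiusOracle F d A B r,
        1 - Fintype.card F * (1 - bhattacharyyaGap K) ^ n ≤ alg.prob O r := by
  let S := candidateRadii F d (Fintype.card A)
  obtain ⟨alg, hnum, hprob⟩ := exists_samplingAlgorithm F d A B n fun o =>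
    strictArgmax S fun v => ∏ j, outcomeProb d (Fintype.card A) v (o j)
  refine ⟨alg, hnum, fun r hr O => ?_⟩
  have hrS : r ∈ S := mem_candidateRadii.mpr ⟨hr, O.card_radiusSphere_le⟩
  have hsuccess := one_sub_le_sum_strictArgmax (S := S) n
    (fun v hv => outcomeProb_nonneg (mem_candidateRadii.mp hv).2) hrS (sum_outcomeProb _ hr)
  have herror : ∑ v ∈ S.erase r, bhattacharyya (outcomeProb d (Fintype.card A) r)
      (outcomeProb d (Fintype.card A) v) ^ n ≤
      (S.erase r).card • (1 - bhattacharyyaGap K) ^ n := by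
    refine Finset.sum_le_card_nsmul _ _ _ fun v hv =>
      pow_le_pow_left₀ (bhattacharyya_nonneg _ _) ?_ n
    obtain ⟨hvr, hvS⟩ := Finset.mem_erase.mp hv
    obtain ⟨hv, hvA⟩ := mem_candidateRadii.mp hvS
    exact bhattacharyya_outcomeProb_le hq hd Fintype.card_pos hA hr O.card_radiusSphere_le hv hvA
      hvr.symm
  have hgap := (bhattacharyyaGap_mem_Ioc (one_le_of_pos_of_le_mul Fintype.card_pos hA)).2
  have hcard : ((S.erase r).card : ℝ) ≤ Fintype.card F := Nat.cast_le.mpr (Finset.card_le_univ _)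
  have hunion := mul_le_mul_of_nonneg_right hcard (pow_nonneg (sub_nonneg.mpr hgap) n)
  rw [nsmul_eq_mul] at herror
  rw [hprob r hr O r]
  linarith

theorem exists_sample_size {τ ε q : ℝ} (hτ : τ ∈ Set.Ioc 0 1) (hε : 0 < ε) (hq : 3 ≤ q) :
    ∃ n : ℕ, 2 * (n : ℝ) ≤ 2 * ((1 + |Real.log ε|) / τ + 1) * Real.log q ∧
      q * (1 - τ) ^ n ≤ ε := by
  obtain ⟨hτ0, hτ1⟩ := hτ
  have hlog : 1 ≤ Real.log q := by
    rw [Real.le_log_iff_exp_le (by linarith)]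
    linarith [Real.exp_one_lt_three]
  have hratio : (Real.log q - Real.log ε) / τ ≤ (1 + |Real.log ε|) / τ * Real.log q := by
    rw [div_mul_eq_mul_div]
    gcongr
    linarith [neg_abs_le (Real.log ε), mul_le_mul_of_nonneg_left hlog (abs_nonneg (Real.log ε))]
  set n := ⌈(Real.log q - Real.log ε) / τ⌉₊
  refine ⟨n, ?_, ?_⟩
  · have hn : (n : ℝ) ≤ (1 + |Real.log ε|) / τ * Real.log q + 1 :=
      (Nat.cast_le.mpr (Nat.ceil_mono hratio)).trans (Nat.ceil_lt_add_one (by positivity)).le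
    linarith
  · have hn : Real.log q - Real.log ε ≤ n * τ := (div_le_iff₀ hτ0).mp (Nat.le_ceil _)
    calc q * (1 - τ) ^ n ≤ q * Real.exp (-τ) ^ n := by
          gcongr
          exact Real.one_sub_le_exp_neg τ
      _ = Real.exp (Real.log q + n * -τ) := by
          rw [Real.exp_add, Real.exp_log (by linarith), Real.exp_nat_mul]
      _ ≤ Real.exp (Real.log ε) := Real.exp_le_exp.mpr (by linarith)
      _ = ε := Real.exp_log hε

theorem exists_queryAlgorithm_numQueries_le_log [DecidableEq F] (A B : Type)
    [AddCommGroup A] [Fintype A] [DecidableEq A] [AddCommGroup B] [Fintype B] [DecidableEq B]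
    {K : ℕ} {ε : ℝ} (hε : 0 < ε) (hq : Odd (Fintype.card F)) (hd : Odd d)
    (hA : Fintype.card A ≤ K * Fintype.card F ^ (d - 1)) :
    ∃ alg : QueryAlgorithm F d A B,
      alg.numQueries ≤ 2 * ((1 + |Real.log ε|) / bhattacharyyaGap K + 1) *
        Real.log (Fintype.card F) ∧
      ∀ r : F, (radiusSphere d r).Nonempty →
        ∀ O : HiddenRadiusOracle F d A B r, 1 - ε ≤ alg.prob O r := by
  obtain ⟨n, hn, herror⟩ := exists_sample_size
    (bhattacharyyaGap_mem_Ioc (one_le_of_pos_of_le_mul Fintype.card_pos hA)) hε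
    (Nat.ofNat_le_cast.mpr (three_le_card_of_odd_card hq))
  obtain ⟨alg, hnum, hprob⟩ := exists_maximumLikelihoodAlgorithm A B hq hd hA n
  refine ⟨alg, ?_, fun r hr O => (sub_le_sub_left herror 1).trans (hprob r hr O)⟩
  rw [hnum]
  exact_mod_cast hn

end HiddenRadiusProblem

theorem mainTheorem4 :
    -- query complexity of the hidden radius problem in odd dimension
    (∀ (K : ℕ) (ε : ℝ), 0 < ε → ∃ (C : ℝ) (c : ℕ),
      ∀ (F : Type) [Field F] [Fintype F] [DecidableEq F] (d : ℕ)
        (A B : Type) [AddCommGroup A] [Fintype A] [DecidableEq A]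
        [AddCommGroup B] [Fintype B] [DecidableEq B],
        Odd (Fintype.card F) → Odd d → Fintype.card A ≤ K * Fintype.card F ^ (d - 1) →
        ∃ alg : QueryAlgorithm F d A B,
          (alg.numQueries : ℝ) ≤ C * Real.log (Fintype.card F) ^ c ∧
          ∀ r : F, (radiusSphere d r).Nonempty →
            ∀ O : HiddenRadiusOracle F d A B r, 1 - ε ≤ alg.prob O r) ∧
    -- constant total variation distance for any two distinct radii
    (∃ δ : ℝ, 0 < δ ∧
      ∀ (F : Type) [Field F] [Fintype F] (d : ℕ) (r r' : F),
        Odd (Fintype.card F) → Odd d →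
        (radiusSphere d r).Nonempty → (radiusSphere d r').Nonempty → r ≠ r' →
        δ ≤ fourierTV d r r') ∧
    -- explicit constant for two radii with the same quadratic character
    (∀ (F : Type) [Field F] [Fintype F] [DecidableEq F] (d : ℕ) (r r' : F),
        Odd (Fintype.card F) → Odd d →
        (radiusSphere d r).Nonempty → (radiusSphere d r').Nonempty → r ≠ r' →
        quadraticChar F r = quadraticChar F r' →
        1 / 4 ≤ fourierTV d r r') := by
  refine ⟨fun K ε hε => ⟨2 * ((1 + |Real.log ε|) / bhattacharyyaGap K + 1), 1, ?_⟩,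
    ⟨1 / 12, by norm_num, ?_⟩, ?_⟩
  · intro F _ _ _ d A B _ _ _ _ _ _ hq hd hA
    simpa only [pow_one] using exists_queryAlgorithm_numQueries_le_log A B hε hq hd hA
  · intro F _ _ d r r' hq hd h h' hne
    exact fourierTV_ge hq hd h h' hne
  · intro F _ _ _ d r r' hq hd h _ hne hχ
    exact fourierTV_ge_of_quadraticChar_eq (ringChar_ne_two_of_odd_card hq) hd h hne hχ
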